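/- **Theorem (Banker-BOLO).** There is an absolute constant $k\in\mathbb N$, and for every $c>0$ a constant $K>0$ depending only on $c$, such that the following holds for all $n\ge 1$ and $T\ge 1$. *Setting.* Let $\mathcal C\subseteq\mathbb R^n$ be a compact convex set with non-empty interior. In round $t=1,\dots,T$ the agent plays $A_t\in\mathcal C$ and suffers the loss $\hat l_t=\langle l_t,A_t\rangle$, where $l_t$ is chosen by an adversary with $|\langle l_t,x\rangle|\le 1$ for all $x\in\mathcal C$; $l_t$ may depend on the agent's random draws in rounds $1,\dots,t-1$ (in particular it may be fixed in advance). The number $\hat l_t$ is revealed at the end of round $t+d_t$, where the delays $d_1,d_2,\dots\in\mathbb N$ are arbitrary, fixed in advance and unknown to the agent. Put $D=\sum_{t=1}^T d_t$ and $$\mathfrak R_T=\sup_{y\in\mathcal C}\mathbb E\Big[\sum_{t=1}^T\langle l_t,A_t-y\rangle\Big].$$ *Barrier.* Let $\Psi$ be a $\vartheta$-self-concordant barrier on $\mathcal C$ with $\vartheta\le c\,n$: $\Psi$ is convex and $C^3$ on $\operatorname{int}\mathcal C$, tends to $+\infty$ at every boundary point of $\mathcal C$, and for all $x\in\operatorname{int}\mathcal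 C$, $h\in\mathbb R^n$, $$|D^3\Psi(x)[h,h,h]|\le 2\,(D^2\Psi(x)[h,h])^{3/2},\qquad |D\Psi(x)[h]|\le\vartheta^{1/2}(D^2\Psi(x)[h,h])^{1/2}.$$ Let $\Psi^*(\theta)=\sup_{x\in\operatorname{int}\mathcal C}(\langle\theta,x\rangle-\Psi(x))$. *Algorithm (Banker-BOLO).* Let $x_0=\nabla\Psi^*(\mathbf 0)$. In round $t$: 1. Let $\mathfrak d_t$ be the number of rounds $s<t$ whose feedback has not arrived before round $t$ (that is, $s+d_s\ge t$), let $\mathfrak D_t=\sum_{s\le t}\mathfrak d_s$, and $$\sigma_t=\max\Big\{\Big(\sqrt{\tfrac{\ln T}{nt}}+\mathfrak d_t\sqrt{\tfrac{\ln(\mathfrak D_t+1)\ln T}{n\mathfrak D_t}}\Big)^{-1},\,8n\Big\},$$ where $0/0$ is read as $0$, and $\sigma_1=8n$ if $T=1$. 2. Set $v_t=\sigma_t$ and $b_t=\sigma_t$. For the rounds $s<t$ whose feedback has arrived, in increasing order, put $\sigma_{t,s}=\min\{v_s,b_t\}$ and replace $b_t$ by $b_t-\sigma_{t,s}$ and $v_s$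 by $v_s-\sigma_{t,s}$; put $\sigma_{t,s}=0$ for the other $s<t$. 3. Let $x_t=\nabla\Psi^*\big(\sum_{s<t}\frac{\sigma_{t,s}}{\sigma_t}\nabla\Psi(z_s)+\frac{b_t}{\sigma_t}\nabla\Psi(x_0)\big)$, and let $e_{t,1},\dots,e_{t,n}$ be any orthonormal eigenbasis of $\nabla^2\Psi(x_t)$ (selected by a fixed rule from $t$ and $x_t$), with eigenvalues $\lambda_{t,1},\dots,\lambda_{t,n}$. 4. Draw $i_t$ uniformly from $\{1,\dots,n\}$ and $\varepsilon_t$ uniformly from $\{\pm1\}$, independently of each other and of the past, and play $A_t=x_t+\varepsilon_t\lambda_{t,i_t}^{-1/2}e_{t,i_t}$. 5. When $\hat l_s$ arrives, set $\tilde l_s=\hat l_s\,n\,\varepsilon_s\lambda_{s,i_s}^{1/2}e_{s,i_s}$ and $z_s=\nabla\Psi^*(\nabla\Psi(x_s)-\sigma_s^{-1}\tilde l_s)$. *Conclusion.* All actions $A_t$ lie in $\mathcal C$, and $$\mathfrak R_T\le K\,(\ln(T+1))^k\,\big(n^{3/2}\sqrt T+n^2\sqrt D\big).$$ In particular $\mathfrak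 R_T=\tilde{\mathcal O}(n^{3/2}\sqrt T+n^2\sqrt D)$. -/

import Mathlib

open scoped BigOperators Topology

noncomputable section

namespace BankerBolo

/-- The ambient Euclidean space `ℝⁿ`. -/
abbrev Vec (n : ℕ) : Type := EuclideanSpace ℝ (Fin n)

/-! ### Self-concordant barriers and mirror maps -/

/-- `Ψ` is self-concordant on (the interior of) `C`: it is convex, `C³`, and
`|D³Ψ(x)[h,h,h]| ≤ 2 (D²Ψ(x)[h,h])^{3/2}`. -/
structure IsSelfConcordant {n : ℕ} (C : Set (Vec n)) (Ψ : Vec n → ℝ) : Prop where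
  contDiffOn : ContDiffOn ℝ 3 Ψ (interior C)
  convexOn : ConvexOn ℝ (interior C) Ψ
  third_le : ∀ x ∈ interior C, ∀ h : Vec n,
    |iteratedFDeriv ℝ 3 Ψ x (fun _ => h)| ≤
      2 * (iteratedFDeriv ℝ 2 Ψ x (fun _ => h)) ^ (3 / 2 : ℝ)

/-- `Ψ` is a `ϑ`-self-concordant barrier on `C`: it is self-concordant, it tends to `+∞` at every
boundary point of `C`, and `|DΨ(x)[h]| ≤ ϑ^{1/2} (D²Ψ(x)[h,h])^{1/2}`. -/
structure IsSelfConcordantBarrier {n : ℕ} (C : Set (Vec n)) (ϑ : ℝ) (Ψ : Vec n → ℝ) : Prop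
    extends IsSelfConcordant C Ψ where
  barrier : ∀ p ∈ frontier C, Filter.Tendsto Ψ (𝓝[interior C] p) Filter.atTop
  first_le : ∀ x ∈ interior C, ∀ h : Vec n,
    |fderiv ℝ Ψ x h| ≤ √ϑ * √(iteratedFDeriv ℝ 2 Ψ x (fun _ => h))

/-- The Fenchel conjugate `Ψ*(θ) = sup_x (⟨θ, x⟩ - Ψ x)`, where `Ψ` is regarded as `+∞` outside
the interior of `C`. -/
def conjugate {n : ℕ} (C : Set (Vec n)) (Ψ : Vec n → ℝ) (θ : Vec n) : ℝ :=
  ⨆ x : interior C, (inner ℝ θ (x : Vec n) - Ψ x)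

/-- The mirror map `∇Ψ*`. -/
def mirror {n : ℕ} (C : Set (Vec n)) (Ψ : Vec n → ℝ) (θ : Vec n) : Vec n :=
  gradient (conjugate C Ψ) θ

/-- The Hessian `∇²Ψ(x)` as a linear operator. -/
def hessian {n : ℕ} (Ψ : Vec n → ℝ) (x : Vec n) : Vec n →L[ℝ] Vec n :=
  fderiv ℝ (gradient Ψ) x

/-- A rule that selects, in round `t` at the point `x`, an orthonormal basis of `ℝⁿ` together with
a list of reals (meant to be eigenvectors and eigenvalues of `∇²Ψ(x)`). -/
structure Frame (n : ℕ) where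
  vec : ℕ → Vec n → OrthonormalBasis (Fin n) ℝ (Vec n)
  val : ℕ → Vec n → Fin n → ℝ

/-- The frame really consists of eigenvectors and eigenvalues of the Hessians of `Ψ`. -/
def Frame.IsEigen {n : ℕ} (F : Frame n) (C : Set (Vec n)) (Ψ : Vec n → ℝ) : Prop :=
  ∀ t : ℕ, ∀ x ∈ interior C, ∀ i : Fin n,
    hessian Ψ x (F.vec t x i) = F.val t x i • F.vec t x i

/-! ### Delays and the bank

Rounds are numbered from `0`, so that round `t` here is the `(t + 1)`-st round. The feedback of
round `s` is revealed at the end of round `s + d s`. -/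

/-- The feedback of round `s` has arrived before the beginning of round `t`. -/
def Arrived (d : ℕ → ℕ) (t s : ℕ) : Prop := s + d s < t

instance (d : ℕ → ℕ) (t s : ℕ) : Decidable (Arrived d t s) :=
  inferInstanceAs (Decidable (s + d s < t))

/-- The number `𝔡_t` of past rounds whose feedback is missing at the beginning of round `t`. -/
def missing (d : ℕ → ℕ) (t : ℕ) : ℕ :=
  ((Finset.range t).filter fun s => ¬ Arrived d t s).card

/-- The experienced delay `𝔇_t`, the sum of `𝔡_s` over all rounds up to and including `t`. -/
def cumMissing (d : ℕ → ℕ) (t : ℕ) : ℕ := ∑ s ∈ Finset.range (t + 1), missing d s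

/-- The action scale `σ_t`. The quotient `0 / 0` for `𝔇_t = 0` (hence `𝔡_t = 0`) is `0`. If `T = 1`
the reciprocal is that of `0` and is read as `0`; the only action does not depend on this. -/
def scale (n T : ℕ) (d : ℕ → ℕ) (t : ℕ) : ℝ :=
  max
    ((√(Real.log T / (n * (t + 1 : ℝ))) +
      missing d t *
        √(Real.log ((cumMissing d t : ℝ) + 1) * Real.log T / (n * (cumMissing d t : ℝ))))⁻¹)
    (8 * n)

/-- Greedy allocation of savings `v` to the scale `σ`: the amount still needed after the
rounds `0, …, s - 1` have been processed in this order; each `r` with `arr r` contributes the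
minimum of its savings and of the amount needed at that time. -/
def need (v : ℕ → ℝ) (arr : ℕ → Prop) [DecidablePred arr] (σ : ℝ) : ℕ → ℝ
  | 0 => σ
  | s + 1 => need v arr σ s - if arr s then min (v s) (need v arr σ s) else 0

/-- The amount taken from the savings of round `s` in the greedy allocation. -/
def take (v : ℕ → ℝ) (arr : ℕ → Prop) [DecidablePred arr] (σ : ℝ) (s : ℕ) : ℝ :=
  if arr s then min (v s) (need v arr σ s) else 0

/-- The savings `v_s` (`s < t`) at the beginning of round `t`, before the allocation in round `t`:
round `s` opens the account with `σ_s`, and every later round takes its allocation from it. -/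
def savings (σ : ℕ → ℝ) (d : ℕ → ℕ) : ℕ → ℕ → ℝ
  | 0, _ => 0
  | t + 1, s =>
      if s = t then σ t else savings σ d t s - take (savings σ d t) (Arrived d t) (σ t) s

/-- The amount `σ_{t,s}` of savings from round `s` that is spent in round `t`. -/
def spend (σ : ℕ → ℝ) (d : ℕ → ℕ) (t s : ℕ) : ℝ :=
  take (savings σ d t) (Arrived d t) (σ t) s

/-- The investment `b_t` in the default action: the part of `σ_t` not covered by savings. -/
def invest (σ : ℕ → ℝ) (d : ℕ → ℕ) (t : ℕ) : ℝ :=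
  need (savings σ d t) (Arrived d t) (σ t) t

/-! ### The algorithm -/

/-- The random draw `(i_t, ε_t)` of one round: an index and a sign. -/
abbrev Draw (n : ℕ) : Type := Fin n × ℤˣ

/-- The sign of a draw as a real number. -/
def Draw.sign {n : ℕ} (a : Draw n) : ℝ := ((a.2 : ℤ) : ℝ)

/-- The draws before round `s`, extracted from the draws before round `t`. -/
def past {n t : ℕ} (h : Fin t → Draw n) (s : Fin t) : Fin s → Draw n :=
  fun r => h (r.castLE s.2.le)

/-- The action `A = x + ε λ_i^{-1/2} e_i` on the Dikin ellipsoid around `x`. -/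
def action {n : ℕ} (F : Frame n) (t : ℕ) (x : Vec n) (a : Draw n) : Vec n :=
  x + (a.sign * (√(F.val t x a.1))⁻¹) • F.vec t x a.1

/-- The loss estimator `⟨l, A⟩ n ε λ_i^{1/2} e_i`; of the loss vector `l` it only uses the observed
loss `⟨l, A⟩`. -/
def estimator {n : ℕ} (F : Frame n) (t : ℕ) (x : Vec n) (a : Draw n) (l : Vec n) : Vec n :=
  (inner ℝ l (action F t x a) * (n * a.sign * √(F.val t x a.1))) • F.vec t x a.1

/-- The mirror step `z = ∇Ψ*(∇Ψ(x) - σ⁻¹ l̃)`. -/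
def mirrorStep {n : ℕ} (C : Set (Vec n)) (Ψ : Vec n → ℝ) (F : Frame n) (σ : ℝ) (t : ℕ)
    (x : Vec n) (a : Draw n) (l : Vec n) : Vec n :=
  mirror C Ψ (gradient Ψ x - σ⁻¹ • estimator F t x a l)

/-- The centre `x_t` of the sampling ellipsoid of round `t`, as a function of the draws of the
earlier rounds:
`x_t = ∇Ψ*(∑_{s<t} (σ_{t,s}/σ_t) ∇Ψ(z_s) + (b_t/σ_t) ∇Ψ(x_0))` with `x_0 = ∇Ψ*(0)`.
The loss vector of round `t` may depend on the draws of the earlier rounds. Since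
`σ_{t,s} = 0` unless the feedback of `s` has arrived, `x_t` uses no feedback before its arrival. -/
def point {n : ℕ} (C : Set (Vec n)) (Ψ : Vec n → ℝ) (F : Frame n) (T : ℕ)
    (l : (t : ℕ) → (Fin t → Draw n) → Vec n) (d : ℕ → ℕ) (t : ℕ) (h : Fin t → Draw n) : Vec n :=
  mirror C Ψ
    ((∑ s : Fin t, (spend (scale n T d) d t s / scale n T d t) •
        gradient Ψ (mirrorStep C Ψ F (scale n T d s) s (point C Ψ F T l d s (past h s)) (h s)
          (l s (past h s)))) +
      (invest (scale n T d) d t / scale n T d t) • gradient Ψ (mirror C Ψ 0))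
termination_by t
decreasing_by exact s.2

/-- The action `A_t` played in round `t` when the draws of the `T` rounds are `ω`. -/
def play {n : ℕ} (C : Set (Vec n)) (Ψ : Vec n → ℝ) (F : Frame n) (T : ℕ)
    (l : (t : ℕ) → (Fin t → Draw n) → Vec n) (d : ℕ → ℕ) (ω : Fin T → Draw n) (t : Fin T) : Vec n :=
  action F t (point C Ψ F T l d t (past ω t)) (ω t)

/-- The pseudo-regret `sup_{y ∈ C} 𝔼 ∑_t ⟨l_t, A_t - y⟩`. The expectation is over `T` independent
draws, uniform on `[n] × {±1}`, that is, the average over all `ω`. -/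
def pseudoRegret {n : ℕ} (C : Set (Vec n)) (Ψ : Vec n → ℝ) (F : Frame n) (T : ℕ)
    (l : (t : ℕ) → (Fin t → Draw n) → Vec n) (d : ℕ → ℕ) : EReal :=
  ⨆ y ∈ C, (((Finset.univ : Finset (Fin T → Draw n)).expect fun ω =>
    ∑ t : Fin T, inner ℝ (l t (past ω t)) (play C Ψ F T l d ω t - y) : ℝ) : EReal)

end BankerBolo

end

open scoped BigOperators Topology

noncomputable section

namespace BankerBolo

section

/-! ### Functions of one real variable -/

/-! Fix the draws and write `B θ = Ψ y + Ψ* θ - ⟨θ, y⟩`, which is convex and nonnegative. Feeding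
round `t`'s estimate into the mirror step moves `∇Ψ(x_t)` to a point `ζ_t`. Self-concordance
(`conjugate_gradient_add_le`) bounds the linear regret of the round by `σ_t (B(∇Ψ(x_t)) - B(ζ_t))`
plus `2n²/σ_t`. Since `∇Ψ(x_t)` is the average of earlier `ζ_s` and of `0` with weights
`σ_{t,s}/σ_t` and `b_t/σ_t`, convexity bounds `σ_t B(∇Ψ(x_t))` by what the bank pays out. Each
account pays out at most its deposit `σ_s`, so everything cancels except the fresh investments: the
regret is at most `(∑ b_t) B(0) + 2n² ∑ 1/σ_t` (`sum_inner_sub_le`).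

The greedy allocation invests only when every arrived account is empty, so `∑ b_t` never exceeds the
largest value of `σ_t` plus the scales still awaiting feedback (`sum_invest_le`). Ordering these
pending rounds, the one of rank `j` saw at least `j` missing feedbacks, so its scale is of order
`√(n𝔇)/j` up to the floor `8n`. A harmonic sum controls the total (`sum_pending_scale_le`), while `∑
1/σ_t` is controlled by `∑ a_t/√(a_0+⋯+a_t) ≤ 2√(∑ a_t)`.

Randomness enters only through unbiasedness of the estimator (`sum_inner_action_eq`,
`sum_past_congr`). The comparator is shrunk towards `x₀` by `1/(T+1)`, which costs at most `2` and
makes `B(0) ≤ ϑ log(T+1)` (`le_sub_log`). -/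

theorem abs_inv_sqrt_sub_le {S : Set ℝ} (hS : Convex ℝ S) {f f' : ℝ → ℝ}
    (hf : ∀ t ∈ S, HasDerivAt f (f' t) t) (hf0 : ∀ t ∈ S, 0 ≤ f t)
    (hf' : ∀ t ∈ S, |f' t| ≤ 2 * f t ^ (3 / 2 : ℝ)) {ε : ℝ} (hε : 0 < ε) {s t : ℝ}
    (hs : s ∈ S) (ht : t ∈ S) :
    |(√(f t + ε))⁻¹ - (√(f s + ε))⁻¹| ≤ |t - s| := by
  -- The shift by `ε` allows `f` to vanish; the hypothesis on `f'` then makes this derivative at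
  -- most `1` in absolute value.
  have key : ∀ x ∈ S, HasDerivWithinAt (fun x => (√(f x + ε))⁻¹)
      (-(f' x / (2 * √(f x + ε))) / √(f x + ε) ^ 2) S x := by
    intro x hx
    have hpos : 0 < f x + ε := by linarith [hf0 x hx]
    exact ((((hf x hx).add_const ε).sqrt hpos.ne').inv (Real.sqrt_pos.2 hpos).ne').hasDerivWithinAt
  have := Convex.norm_image_sub_le_of_norm_hasDerivWithin_le (C := 1) key (fun x hx => ?_) hS hs ht
  · simpa [Real.norm_eq_abs] using this
  · have hfx := hf0 x hx
    have hpos : 0 < f x + ε := by linarith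
    have hq := Real.sqrt_pos.2 hpos
    have hpq : √(f x) ≤ √(f x + ε) := Real.sqrt_le_sqrt (by linarith)
    have hp := Real.sqrt_nonneg (f x)
    have h32 : f x ^ (3 / 2 : ℝ) = √(f x) ^ 3 := by
      rw [Real.sqrt_eq_rpow, ← Real.rpow_natCast, ← Real.rpow_mul hfx]; norm_num
    have h1 := hf' x hx
    rw [h32] at h1
    have h2 : √(f x) ^ 3 ≤ √(f x + ε) ^ 3 := pow_le_pow_left₀ hp hpq 3
    rw [Real.norm_eq_abs, abs_div, abs_neg, abs_div, abs_of_pos (by positivity : 0 < 2 * √(f x + ε)),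
      abs_of_pos (by positivity : 0 < √(f x + ε) ^ 2), div_div, div_le_one (by positivity)]
    nlinarith

/-- The limit `ε → 0` of the Lipschitz bound on `(f + ε)^{-1/2}`, cleared of denominators because
`f` may vanish. -/
theorem sqrt_le_sqrt_mul_of_abs_deriv_le {S : Set ℝ} (hS : Convex ℝ S) {f f' : ℝ → ℝ}
    (hf : ∀ t ∈ S, HasDerivAt f (f' t) t) (hf0 : ∀ t ∈ S, 0 ≤ f t)
    (hf' : ∀ t ∈ S, |f' t| ≤ 2 * f t ^ (3 / 2 : ℝ)) {s t : ℝ} (hs : s ∈ S) (ht : t ∈ S) :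
    √(f s) ≤ √(f t) * (1 + |t - s| * √(f s)) := by
  have h : ∀ ε ∈ Set.Ioi (0 : ℝ), √(f s + ε) ≤ √(f t + ε) * (1 + |t - s| * √(f s + ε)) := by
    intro ε hε
    have hε : 0 < ε := hε
    have h1 := (abs_le.1 (abs_inv_sqrt_sub_le hS hf hf0 hf' hε hs ht)).2
    have hps : 0 < √(f s + ε) := Real.sqrt_pos.2 (by linarith [hf0 s hs])
    have hpt : 0 < √(f t + ε) := Real.sqrt_pos.2 (by linarith [hf0 t ht])
    have h2 : (√(f t + ε))⁻¹ ≤ (√(f s + ε))⁻¹ + |t - s| := by linarith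
    have h3 := mul_le_mul_of_nonneg_left h2 (mul_pos hps hpt).le
    have e1 : √(f s + ε) * √(f t + ε) * (√(f t + ε))⁻¹ = √(f s + ε) := by field_simp
    have e2 : √(f s + ε) * √(f t + ε) * ((√(f s + ε))⁻¹ + |t - s|)
        = √(f t + ε) * (1 + |t - s| * √(f s + ε)) := by field_simp
    rwa [e1, e2] at h3
  have h0 : (0 : ℝ) ∈ closure (Set.Ioi (0 : ℝ)) := by rw [closure_Ioi]; simp
  have := ContinuousWithinAt.closure_le h0
    (Continuous.continuousWithinAt (by fun_prop)) (Continuous.continuousWithinAt (by fun_prop)) h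
  simpa using this

theorem le_of_second_deriv_nonneg {g g' g'' : ℝ → ℝ}
    (hg : ∀ t ∈ Set.Icc (0 : ℝ) 1, HasDerivAt g (g' t) t)
    (hg' : ∀ t ∈ Set.Icc (0 : ℝ) 1, HasDerivAt g' (g'' t) t)
    (hg'' : ∀ t ∈ Set.Icc (0 : ℝ) 1, 0 ≤ g'' t) : g 0 + g' 0 ≤ g 1 := by
  have hc : ConvexOn ℝ (Set.Icc (0 : ℝ) 1) g :=
    convexOn_of_hasDerivWithinAt2_nonneg (convex_Icc 0 1)
      (fun t ht => (hg t ht).continuousAt.continuousWithinAt)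
      (fun t ht => (hg t (interior_subset ht)).hasDerivWithinAt)
      (fun t ht => (hg' t (interior_subset ht)).hasDerivWithinAt)
      (fun t ht => hg'' t (interior_subset ht))
  have := hc.le_slope_of_hasDerivAt (x := 0) (y := 1) (by simp) (by simp) one_pos (hg 0 (by simp))
  simp [slope_def_field] at this
  linarith

/-! ### Restriction of a self-concordant function to a line -/

/-- The quadratic form `D²Ψ(x)[h,h]`. -/
def quad {n : ℕ} (Ψ : Vec n → ℝ) (x h : Vec n) : ℝ := iteratedFDeriv ℝ 2 Ψ x (fun _ => h)

variable {n : ℕ} {C : Set (Vec n)} {Ψ : Vec n → ℝ}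

theorem hasDerivAt_iteratedFDeriv_line (hΨ : ContDiffOn ℝ 3 Ψ (interior C)) {k : ℕ} (hk : k < 3)
    {x h : Vec n} {t : ℝ} (hx : x + t • h ∈ interior C) :
    HasDerivAt (fun t : ℝ => iteratedFDeriv ℝ k Ψ (x + t • h) (fun _ => h))
      (iteratedFDeriv ℝ (k + 1) Ψ (x + t • h) (fun _ => h)) t := by
  have hc : ContDiffAt ℝ 3 Ψ (x + t • h) := hΨ.contDiffAt (isOpen_interior.mem_nhds hx)
  have hd : DifferentiableAt ℝ (iteratedFDeriv ℝ k Ψ) (x + t • h) :=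
    hc.differentiableAt_iteratedFDeriv (by exact_mod_cast hk)
  have hl : HasDerivAt (fun t : ℝ => x + t • h) h t := by
    simpa using ((hasDerivAt_id t).smul_const h).const_add x
  have h1 := hd.hasFDerivAt.comp_hasDerivAt t hl
  have h2 := ((ContinuousMultilinearMap.apply ℝ (fun _ : Fin k => Vec n) ℝ
    (fun _ => h)).hasFDerivAt).comp_hasDerivAt t h1
  rw [iteratedFDeriv_succ_apply_left]
  exact h2

theorem hasDerivAt_line (hΨ : ContDiffOn ℝ 3 Ψ (interior C))
    {x h : Vec n} {t : ℝ} (hx : x + t • h ∈ interior C) :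
    HasDerivAt (fun t : ℝ => Ψ (x + t • h)) (fderiv ℝ Ψ (x + t • h) h) t := by
  simpa using hasDerivAt_iteratedFDeriv_line hΨ (k := 0) (by norm_num) hx

theorem hasDerivAt_fderiv_line (hΨ : ContDiffOn ℝ 3 Ψ (interior C))
    {x h : Vec n} {t : ℝ} (hx : x + t • h ∈ interior C) :
    HasDerivAt (fun t : ℝ => fderiv ℝ Ψ (x + t • h) h) (quad Ψ (x + t • h) h) t := by
  simpa [quad] using hasDerivAt_iteratedFDeriv_line hΨ (k := 1) (by norm_num) hx

theorem hasDerivAt_quad_line (hΨ : ContDiffOn ℝ 3 Ψ (interior C))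
    {x h : Vec n} {t : ℝ} (hx : x + t • h ∈ interior C) :
    HasDerivAt (fun t : ℝ => quad Ψ (x + t • h) h)
      (iteratedFDeriv ℝ 3 Ψ (x + t • h) (fun _ => h)) t :=
  hasDerivAt_iteratedFDeriv_line hΨ (k := 2) (by norm_num) hx

theorem quad_smul (x h : Vec n) (a : ℝ) : quad Ψ x (a • h) = a ^ 2 * quad Ψ x h := by
  have := (iteratedFDeriv ℝ 2 Ψ x).map_smul_univ (fun _ => a) (fun _ => h)
  simpa [quad] using this

namespace IsSelfConcordant

variable (hΨ : IsSelfConcordant C Ψ)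
include hΨ

theorem fderiv_le_sub {x y : Vec n} (hx : x ∈ interior C) (hy : y ∈ interior C) :
    Ψ x + fderiv ℝ Ψ x (y - x) ≤ Ψ y := by
  have hconv : ConvexOn ℝ (Set.Icc (0 : ℝ) 1) (fun t : ℝ => Ψ (x + t • (y - x))) := by
    have := hΨ.convexOn.comp_affineMap (AffineMap.lineMap x y)
    refine (this.subset (fun t ht => ?_) (convex_Icc 0 1)).congr (fun t _ => ?_)
    · exact hΨ.convexOn.1.lineMap_mem hx hy ht
    · simp [AffineMap.lineMap_apply, add_comm]
  have h0 : x + (0 : ℝ) • (y - x) ∈ interior C := by simpa using hx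
  have := hconv.le_slope_of_hasDerivAt (x := 0) (y := 1) (by simp) (by simp) one_pos
    (hasDerivAt_line hΨ.contDiffOn h0)
  simp [slope_def_field] at this
  simp only [map_sub] at *
  linarith

/-- The gradient of a convex function is monotone, so its difference quotients along `h` are
nonnegative, and so is their limit. -/
theorem quad_nonneg {x : Vec n} (hx : x ∈ interior C) (h : Vec n) : 0 ≤ quad Ψ x h := by
  have h0 : x + (0 : ℝ) • h ∈ interior C := by simpa using hx
  have hcont : Filter.Tendsto (fun t : ℝ => x + t • h) (𝓝[>] 0) (𝓝 x) := by
    have : Continuous (fun t : ℝ => x + t • h) := by fun_prop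
    simpa using (this.tendsto 0).mono_left nhdsWithin_le_nhds
  have hev : ∀ᶠ t in 𝓝[>] (0 : ℝ), 0 ≤ t⁻¹ • (fderiv ℝ Ψ (x + (0 + t) • h) h -
      fderiv ℝ Ψ (x + (0 : ℝ) • h) h) := by
    filter_upwards [hcont (isOpen_interior.mem_nhds hx), self_mem_nhdsWithin] with t ht ht0
    have ht0 : 0 < t := ht0
    have h1 := hΨ.fderiv_le_sub hx ht
    have h2 := hΨ.fderiv_le_sub ht hx
    simp only [add_sub_cancel_left, sub_add_cancel_left, map_smul, map_neg, smul_eq_mul] at h1 h2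
    simp only [zero_add, zero_smul, add_zero, smul_eq_mul]
    have : 0 ≤ t * (fderiv ℝ Ψ (x + t • h) h - fderiv ℝ Ψ x h) := by linarith
    exact mul_nonneg (inv_pos.2 ht0).le (nonneg_of_mul_nonneg_right this ht0)
  have hd' := hasDerivAt_fderiv_line hΨ.contDiffOn h0
  rw [hasDerivAt_iff_tendsto_slope_zero] at hd'
  have := ge_of_tendsto (hd'.mono_left (nhdsWithin_mono _ (fun t (ht : t ∈ Set.Ioi (0 : ℝ)) => ne_of_gt ht))) hev
  simpa using this

theorem sqrt_quad_le {x h : Vec n} (hx : x ∈ interior C) {t : ℝ} (ht : 0 ≤ t)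
    (hxt : x + t • h ∈ interior C) :
    √(quad Ψ x h) ≤ √(quad Ψ (x + t • h) h) * (1 + t * √(quad Ψ x h)) := by
  have hS : ∀ s ∈ Set.Icc 0 t, x + s • h ∈ interior C := fun s hs => by
    have := hΨ.convexOn.1.add_smul_sub_mem hx hxt (t := s / t)
      ⟨div_nonneg hs.1 ht, div_le_one_of_le₀ hs.2 ht⟩
    rcases ht.eq_or_lt with rfl | h0
    · have : s = 0 := le_antisymm hs.2 hs.1
      simpa [this] using hx
    · rwa [add_sub_cancel_left, smul_smul, div_mul_cancel₀ _ h0.ne'] at this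
  have := sqrt_le_sqrt_mul_of_abs_deriv_le (convex_Icc 0 t)
    (fun s hs => hasDerivAt_quad_line hΨ.contDiffOn (hS s hs))
    (fun s hs => hΨ.quad_nonneg (hS s hs) h)
    (fun s hs => hΨ.third_le _ (hS s hs) h) (s := 0) (t := t) (by simp [ht]) (by simp [ht])
  simpa [abs_of_nonneg ht] using this

/-- Along the segment the second derivative is at least `r²/(1+tr)²` by `sqrt_quad_le`; integrating
this twice produces `r - log(1+r)`. -/
theorem add_fderiv_add_le {x h : Vec n} (hx : x ∈ interior C) (hxh : x + h ∈ interior C) :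
    Ψ x + fderiv ℝ Ψ x h + (√(quad Ψ x h) - Real.log (1 + √(quad Ψ x h))) ≤ Ψ (x + h) := by
  set r := √(quad Ψ x h) with hr
  have hr0 : 0 ≤ r := Real.sqrt_nonneg _
  have hS : ∀ s ∈ Set.Icc (0 : ℝ) 1, x + s • h ∈ interior C := fun s hs => by
    simpa using hΨ.convexOn.1.add_smul_sub_mem hx hxh hs
  have hp : ∀ t ∈ Set.Icc (0 : ℝ) 1, 0 < 1 + t * r := fun t ht => by
    have := mul_nonneg ht.1 hr0; linarith
  have hlin : ∀ t : ℝ, HasDerivAt (fun t : ℝ => 1 + t * r) r t := fun t => by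
    simpa using ((hasDerivAt_id t).mul_const r).const_add 1
  have := le_of_second_deriv_nonneg
    (g := fun t => Ψ (x + t • h) - t * fderiv ℝ Ψ x h - (t * r - Real.log (1 + t * r)))
    (g' := fun t => fderiv ℝ Ψ (x + t • h) h - fderiv ℝ Ψ x h - (r - r / (1 + t * r)))
    (g'' := fun t => quad Ψ (x + t • h) h - (r * r) / (1 + t * r) ^ 2) ?_ ?_ ?_
  · simp only [zero_smul, add_zero, zero_mul, one_smul, one_mul, Real.log_one] at this
    simp at this
    linarith
  · intro t ht
    refine ((hasDerivAt_line hΨ.contDiffOn (hS t ht)).sub ?_).sub (HasDerivAt.sub ?_ ?_)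
    · simpa using (hasDerivAt_id t).mul_const (fderiv ℝ Ψ x h)
    · simpa using (hasDerivAt_id t).mul_const r
    · exact (hlin t).log (hp t ht).ne'
  · intro t ht
    have h1 := ((hasDerivAt_fderiv_line hΨ.contDiffOn (hS t ht)).sub_const
      (fderiv ℝ Ψ x h)).sub ((((hlin t).inv (hp t ht).ne').const_mul r).const_sub r)
    refine (h1.congr_deriv ?_)
    ring
  · intro t ht
    have h1 := hΨ.sqrt_quad_le hx ht.1 (hS t ht)
    rw [← hr] at h1
    have h2 := mul_self_le_mul_self hr0 h1
    have h3 := Real.mul_self_sqrt (hΨ.quad_nonneg (hS t ht) h)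
    rw [sub_nonneg, div_le_iff₀ (by have := hp t ht; positivity)]
    calc r * r ≤ _ := h2
      _ = (√(quad Ψ (x + t • h) h) * √(quad Ψ (x + t • h) h)) * (1 + t * r) ^ 2 := by ring
      _ = _ := by rw [h3]

end IsSelfConcordant

end

section

variable {n : ℕ} {C : Set (Vec n)} {Ψ : Vec n → ℝ} {ϑ : ℝ}

/-! ### Gradient and Hessian -/

theorem inner_gradient (f : Vec n → ℝ) (x h : Vec n) : inner ℝ (gradient f x) h = fderiv ℝ f x h := by
  rw [gradient, InnerProductSpace.toDual_symm_apply]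

theorem inner_hessian (f : Vec n → ℝ) (x h k : Vec n) :
    inner ℝ (hessian f x h) k = fderiv ℝ (fderiv ℝ f) x h k := by
  have : gradient f = (InnerProductSpace.toDual ℝ (Vec n)).symm ∘ fderiv ℝ f := rfl
  rw [hessian, this, LinearIsometryEquiv.comp_fderiv]
  simp only [ContinuousLinearMap.comp_apply]
  exact InnerProductSpace.toDual_symm_apply

theorem quad_eq_inner_hessian (x h : Vec n) : quad Ψ x h = inner ℝ (hessian Ψ x h) h := by
  rw [quad, iteratedFDeriv_two_apply, inner_hessian]

/-! ### The Dikin ellipsoid -/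

theorem IsSelfConcordant.sqrt_quad_mul_le (hΨ : IsSelfConcordant C Ψ) {x h : Vec n}
    (hx : x ∈ interior C) {t : ℝ} (ht : 0 ≤ t) (hxt : x + t • h ∈ interior C) :
    √(quad Ψ (x + t • h) h) * (1 - t * √(quad Ψ x h)) ≤ √(quad Ψ x h) := by
  have hneg : ∀ y, quad Ψ y (-h) = quad Ψ y h := fun y => by
    simpa using quad_smul (Ψ := Ψ) y h (-1)
  have h1 := hΨ.sqrt_quad_le (h := -h) hxt ht (by simpa using hx)
  simp only [smul_neg, add_neg_cancel_right, hneg] at h1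
  linarith

namespace IsSelfConcordantBarrier

variable (hΨ : IsSelfConcordantBarrier C ϑ Ψ)
include hΨ

/-- Lets `ϑ` be replaced by `c * n`, which is positive, as the growth bound `le_sub_log` requires.
-/
theorem mono {ϑ' : ℝ} (h : ϑ ≤ ϑ') : IsSelfConcordantBarrier C ϑ' Ψ :=
  { hΨ with
    first_le := fun x hx v => (hΨ.first_le x hx v).trans
      (mul_le_mul_of_nonneg_right (Real.sqrt_le_sqrt h) (Real.sqrt_nonneg _)) }

theorem fderiv_le {x : Vec n} (hx : x ∈ interior C) (h : Vec n) :
    |fderiv ℝ Ψ x h| ≤ √ϑ * √(quad Ψ x h) := hΨ.first_le x hx h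

/-- If the segment left the interior, then up to its first exit time the local norm of `h` would
stay below `r/(1-r)`. The barrier inequality would then keep `Ψ` bounded, against its blow-up at the
boundary. -/
theorem add_mem_interior {x h : Vec n} (hx : x ∈ interior C)
    (hq : quad Ψ x h < 1) : x + h ∈ interior C := by
  by_contra hxh
  have hcont : Continuous (fun t : ℝ => x + t • h) := by fun_prop
  set S : Set ℝ := Set.Icc 0 1 ∩ (fun t : ℝ => x + t • h) ⁻¹' (interior C)ᶜ with hS
  have hSc : IsCompact S :=
    isCompact_Icc.inter_right (isOpen_interior.isClosed_compl.preimage hcont)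
  obtain ⟨b, hbS, hb⟩ := hSc.exists_isLeast ⟨1, by simp, by simpa using hxh⟩
  have hb0 : 0 < b := by
    refine lt_of_le_of_ne hbS.1.1 (fun h0 => hbS.2 ?_)
    simpa [← h0] using hx
  have hin : ∀ t ∈ Set.Ico 0 b, x + t • h ∈ interior C := fun t ht => by
    by_contra hc
    exact absurd (hb ⟨⟨ht.1, ht.2.le.trans hbS.1.2⟩, hc⟩) (not_le.2 ht.2)
  set r := √(quad Ψ x h)
  have hr0 : 0 ≤ r := Real.sqrt_nonneg _
  have hr1 : r < 1 := by
    rw [Real.sqrt_lt' one_pos]; simpa using hq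
  have hbd : ∀ t ∈ Set.Ico 0 b, Ψ (x + t • h) ≤ Ψ x + √ϑ * (r / (1 - r)) := fun t ht => by
    have hxt := hin t ht
    have ht1 : t ≤ 1 := ht.2.le.trans hbS.1.2
    have h1 := hΨ.toIsSelfConcordant.fderiv_le_sub hxt hx
    simp only [sub_add_cancel_left, map_neg, map_smul, smul_eq_mul] at h1
    have h2 := (abs_le.1 (hΨ.fderiv_le hxt h)).2
    have h3 := hΨ.toIsSelfConcordant.sqrt_quad_mul_le hx ht.1 hxt
    have h4 : √(quad Ψ (x + t • h) h) ≤ r / (1 - r) := by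
      rw [le_div_iff₀ (by linarith)]
      refine le_trans (mul_le_mul_of_nonneg_left ?_ (Real.sqrt_nonneg _)) h3
      nlinarith
    have h5 : √ϑ * √(quad Ψ (x + t • h) h) ≤ √ϑ * (r / (1 - r)) :=
      mul_le_mul_of_nonneg_left h4 (Real.sqrt_nonneg _)
    have h6 : 0 ≤ √ϑ * (r / (1 - r)) :=
      mul_nonneg (Real.sqrt_nonneg _) (div_nonneg hr0 (by linarith))
    nlinarith [ht.1, mul_le_mul_of_nonneg_left (h2.trans h5) ht.1]
  have htend : Filter.Tendsto (fun t : ℝ => x + t • h) (𝓝[<] b) (𝓝[interior C] (x + b • h)) := by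
    refine tendsto_nhdsWithin_iff.2 ⟨(hcont.tendsto b).mono_left nhdsWithin_le_nhds, ?_⟩
    filter_upwards [Ico_mem_nhdsLT hb0] with t ht using hin t ht
  have hfr : x + b • h ∈ frontier C := by
    refine ⟨?_, hbS.2⟩
    have : x + b • h ∈ closure (interior C) := mem_closure_iff_nhdsWithin_neBot.2 htend.neBot
    exact closure_mono interior_subset this
  have htop := (hΨ.barrier _ hfr).comp htend
  obtain ⟨t, ht1, ht2⟩ := ((htop.eventually_gt_atTop (Ψ x + √ϑ * (r / (1 - r)))).and
    (Ico_mem_nhdsLT hb0)).exists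
  exact absurd (hbd t ht2) (not_le.2 ht1)

theorem add_mem (hC : IsClosed C) {x h : Vec n} (hx : x ∈ interior C)
    (hq : quad Ψ x h ≤ 1) : x + h ∈ C := by
  have hcont : Continuous (fun t : ℝ => x + t • h) := by fun_prop
  have ht : Filter.Tendsto (fun t : ℝ => x + t • h) (𝓝[<] 1) (𝓝 (x + h)) := by
    simpa using (hcont.tendsto 1).mono_left nhdsWithin_le_nhds
  refine hC.mem_of_tendsto ht ?_
  filter_upwards [Ico_mem_nhdsLT (zero_lt_one (α := ℝ))] with t ht
  refine interior_subset (hΨ.add_mem_interior hx ?_)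
  rw [quad_smul]
  have h0 := hΨ.toIsSelfConcordant.quad_nonneg hx h
  nlinarith [ht.1, ht.2]

/-- A direction of zero curvature would place a whole line inside the Dikin ellipsoid, hence inside
the bounded set `C`. -/
theorem quad_pos (hC : IsCompact C) {x h : Vec n} (hx : x ∈ interior C) (hh : h ≠ 0) :
    0 < quad Ψ x h := by
  refine lt_of_le_of_ne (hΨ.toIsSelfConcordant.quad_nonneg hx h) (fun h0 => ?_)
  obtain ⟨R, hR⟩ := hC.isBounded.exists_norm_le
  have hall : ∀ s : ℝ, ‖x + s • h‖ ≤ R := fun s => by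
    refine hR _ (interior_subset (hΨ.add_mem_interior hx ?_))
    rw [quad_smul, ← h0]; simp
  have hpos := norm_pos_iff.2 hh
  have h1 := hall ((R + ‖x‖ + 1) / ‖h‖)
  have h2 := norm_sub_norm_le (((R + ‖x‖ + 1) / ‖h‖) • h) (-x)
  rw [sub_neg_eq_add, add_comm _ x, norm_neg, norm_smul, Real.norm_eq_abs, abs_div,
    abs_of_pos hpos, div_mul_cancel₀ _ hpos.ne'] at h2
  have h3 := le_abs_self (R + ‖x‖ + 1)
  linarith

/-! ### Growth along segments -/

/-- The barrier inequality says exactly that `exp(-Ψ/ϑ)` is concave along the segment. Being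
positive, it decays at most linearly towards `y`. -/
theorem le_sub_log (hC : Convex ℝ C) (hϑ : 0 < ϑ) {x y : Vec n} (hx : x ∈ interior C)
    (hy : y ∈ C) {t : ℝ} (ht0 : 0 ≤ t) (ht1 : t < 1) :
    Ψ (x + t • (y - x)) ≤ Ψ x - ϑ * Real.log (1 - t) := by
  have hS : ∀ s ∈ Set.Ico (0 : ℝ) 1, x + s • (y - x) ∈ interior C := fun s hs => by
    have h1 := hC.add_smul_sub_mem_interior hy hx (t := 1 - s)
      ⟨by linarith [hs.2], by linarith [hs.1]⟩
    have e : y + (1 - s) • (x - y) = x + s • (y - x) := by module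
    rwa [e] at h1
  set f : ℝ → ℝ := fun s => Real.exp (-Ψ (x + s • (y - x)) / ϑ) with hf
  have hconc : ConcaveOn ℝ (Set.Ico (0 : ℝ) 1) f := by
    have hd : ∀ s ∈ Set.Ico (0 : ℝ) 1,
        HasDerivAt f (f s * (-fderiv ℝ Ψ (x + s • (y - x)) (y - x) / ϑ)) s := fun s hs =>
      (((hasDerivAt_line hΨ.contDiffOn (hS s hs)).neg).div_const ϑ).exp
    refine concaveOn_of_hasDerivWithinAt2_nonpos (convex_Ico 0 1)
      (fun s hs => (hd s hs).continuousAt.continuousWithinAt)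
      (fun s hs => (hd s (interior_subset hs)).hasDerivWithinAt)
      (fun s hs => ((hd s (interior_subset hs)).mul
        (((hasDerivAt_fderiv_line hΨ.contDiffOn
          (hS s (interior_subset hs))).neg).div_const ϑ)).hasDerivWithinAt)
      (fun s hs => ?_)
    have hxs := hS s (interior_subset hs)
    have h1 := hΨ.fderiv_le hxs (y - x)
    have h2 : fderiv ℝ Ψ (x + s • (y - x)) (y - x) ^ 2 ≤ ϑ * quad Ψ (x + s • (y - x)) (y - x) := by
      have h3 := pow_le_pow_left₀ (abs_nonneg _) h1 2
      rwa [sq_abs, mul_pow, Real.sq_sqrt hϑ.le,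
        Real.sq_sqrt (hΨ.toIsSelfConcordant.quad_nonneg hxs _)] at h3
    have e : ∀ a p q : ℝ, a * (-p / ϑ) * (-p / ϑ) + a * (-q / ϑ)
        = -(a * (ϑ * q - p ^ 2) / ϑ ^ 2) := fun a p q => by field_simp; ring
    simp only [Pi.neg_apply]
    rw [e, neg_nonpos]
    have := Real.exp_pos (-Ψ (x + s • (y - x)) / ϑ)
    exact div_nonneg (mul_nonneg this.le (by linarith)) (by positivity)
  have hpos : ∀ s, 0 < f s := fun s => Real.exp_pos _
  -- The endpoint `y` may lie on the boundary, so concavity is used up to `s < 1`, followed by `s →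
  -- 1`.
  have hle : ∀ s ∈ Set.Ioo t 1, (s - t) * f 0 ≤ s * f t := fun s hs => by
    have hs0 : 0 < s := ht0.trans_lt hs.1
    have h1 := hconc.2 (by simp : (0 : ℝ) ∈ Set.Ico (0 : ℝ) 1)
      (⟨hs0.le, hs.2⟩ : s ∈ Set.Ico (0 : ℝ) 1) (by rw [sub_nonneg, div_le_one hs0]; exact hs.1.le : 0 ≤ 1 - t / s)
      (by positivity : 0 ≤ t / s) (by ring)
    simp only [smul_eq_mul, mul_zero, zero_add, div_mul_cancel₀ _ hs0.ne'] at h1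
    have h2 : 0 ≤ t / s * f s := mul_nonneg (by positivity) (hpos s).le
    have h3 : s * ((1 - t / s) * f 0) ≤ s * f t := mul_le_mul_of_nonneg_left (by linarith) hs0.le
    have e : s * ((1 - t / s) * f 0) = (s - t) * f 0 := by field_simp
    rwa [e] at h3
  have hlim : (1 - t) * f 0 ≤ 1 * f t := by
    refine ContinuousWithinAt.closure_le (s := Set.Ioo t 1) (f := fun s => (s - t) * f 0)
      (g := fun s => s * f t) (x := 1) ?_ ?_ ?_ hle
    · rw [closure_Ioo ht1.ne]; exact ⟨ht1.le, le_rfl⟩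
    · exact Continuous.continuousWithinAt (by fun_prop)
    · exact Continuous.continuousWithinAt (by fun_prop)
  have h1t : 0 < 1 - t := by linarith
  have hlog := Real.log_le_log (mul_pos h1t (hpos 0)) hlim
  rw [one_mul, Real.log_mul h1t.ne' (hpos 0).ne', hf] at hlog
  simp only [Real.log_exp, zero_smul, add_zero] at hlog
  rw [← sub_nonneg] at hlog ⊢
  have := mul_nonneg hϑ.le hlog
  have e : ∀ L p q : ℝ, ϑ * (-p / ϑ - (L + -q / ϑ)) = q - ϑ * L - p := fun L p q => by
    field_simp; ring
  rwa [e] at this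

/-! ### The conjugate and the mirror map -/

/-- The barrier property makes the sublevel sets of `Ψ - ⟨θ, ·⟩` compact, so a minimiser exists in
the interior; its critical point equation is the claim. -/
theorem exists_gradient_eq (hC : IsCompact C) (hne : (interior C).Nonempty) (θ : Vec n) :
    ∃ x ∈ interior C, gradient Ψ x = θ := by
  obtain ⟨p, hp⟩ := hne
  set G : Vec n → ℝ := fun x => Ψ x - inner ℝ θ x with hG
  have hin : Continuous (fun x : Vec n => inner ℝ θ x) := by fun_prop
  have hGc : ContinuousOn G (interior C) := hΨ.contDiffOn.continuousOn.sub hin.continuousOn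
  set S : Set (Vec n) := {x ∈ interior C | G x ≤ G p} with hS
  have hScl : IsClosed S := by
    refine isClosed_of_closure_subset (fun x hx => ?_)
    have hxC : x ∈ C :=
      hC.isClosed.closure_subset_iff.2 (fun y hy => interior_subset hy.1) hx
    have hne : (𝓝[S] x).NeBot := mem_closure_iff_nhdsWithin_neBot.1 hx
    have hSm : S ∈ 𝓝[S] x := self_mem_nhdsWithin
    have hmono : 𝓝[S] x ≤ 𝓝[interior C] x := nhdsWithin_mono _ (fun y hy => hy.1)
    by_cases hxi : x ∈ interior C
    · refine ⟨hxi, le_of_tendsto ((hGc x hxi).mono_left hmono) ?_⟩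
      filter_upwards [hSm] with y hy using hy.2
    · exfalso
      have h1 := (hΨ.barrier x ⟨subset_closure hxC, hxi⟩).mono_left hmono
      have h2 : Filter.Tendsto (fun y : Vec n => inner ℝ θ y) (𝓝[S] x) (𝓝 (inner ℝ θ x)) :=
        (hin.tendsto x).mono_left nhdsWithin_le_nhds
      have h3 := Filter.tendsto_atTop_add_right_of_le' (𝓝[S] x) (-(inner ℝ θ x + 1)) h1
        (g := fun y => -inner ℝ θ y) (by
          filter_upwards [h2.eventually (gt_mem_nhds (lt_add_one _))] with y hy
          linarith)
      obtain ⟨y, hy1, hy2⟩ := ((h3.eventually_gt_atTop (G p)).and hSm).exists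
      have := hy2.2
      simp only [hG] at this hy1
      linarith
  have hSc : IsCompact S := hC.of_isClosed_subset hScl (fun y hy => interior_subset hy.1)
  obtain ⟨x, hxS, hx⟩ := hSc.exists_isMinOn ⟨p, hp, le_rfl⟩ (hGc.mono (fun y hy => hy.1))
  have hxi : x ∈ interior C := hxS.1
  refine ⟨x, hxi, ?_⟩
  have hmin : IsLocalMin G x := by
    filter_upwards [isOpen_interior.mem_nhds hxi] with y hy
    by_cases h : G y ≤ G p
    · exact hx ⟨hy, h⟩
    · exact hxS.2.trans (not_le.1 h).le
  have hd : DifferentiableAt ℝ Ψ x :=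
    (hΨ.contDiffOn.contDiffAt (isOpen_interior.mem_nhds hxi)).differentiableAt (by norm_num)
  have h1 := hmin.hasFDerivAt_eq_zero
    (hd.hasFDerivAt.sub (innerSL ℝ θ).hasFDerivAt)
  rw [gradient, sub_eq_zero.1 h1]
  exact (InnerProductSpace.toDual ℝ (Vec n)).symm_apply_apply θ

/-- Ensures that the real-valued supremum defining the conjugate is a true supremum and not a
default value. -/
theorem bddAbove_conjugate (hC : IsCompact C) (hne : (interior C).Nonempty) (θ : Vec n) :
    BddAbove (Set.range fun x : interior C => (inner ℝ θ (x : Vec n) - Ψ x)) := by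
  obtain ⟨x, hx, hxθ⟩ := hΨ.exists_gradient_eq hC hne θ
  refine ⟨inner ℝ θ x - Ψ x, ?_⟩
  rintro _ ⟨⟨y, hy⟩, rfl⟩
  have h1 := hΨ.toIsSelfConcordant.fderiv_le_sub hx hy
  rw [← inner_gradient, hxθ, inner_sub_right] at h1
  show inner ℝ θ y - Ψ y ≤ _
  linarith

theorem le_conjugate (hC : IsCompact C) {y : Vec n} (hy : y ∈ interior C) (θ : Vec n) :
    inner ℝ θ y - Ψ y ≤ conjugate C Ψ θ :=
  le_ciSup (hΨ.bddAbove_conjugate hC ⟨y, hy⟩ θ) ⟨y, hy⟩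

theorem conjugate_gradient (hC : IsCompact C) {x : Vec n} (hx : x ∈ interior C) :
    conjugate C Ψ (gradient Ψ x) = inner ℝ (gradient Ψ x) x - Ψ x := by
  have : Nonempty (interior C) := ⟨⟨x, hx⟩⟩
  refine le_antisymm (ciSup_le ?_) (hΨ.le_conjugate hC hx _)
  rintro ⟨y, hy⟩
  have h1 := hΨ.toIsSelfConcordant.fderiv_le_sub hx hy
  rw [← inner_gradient, inner_sub_right] at h1
  show inner ℝ _ y - Ψ y ≤ _
  linarith

/-- The stability estimate. By `add_fderiv_add_le`, the gain at distance `r` is at most `s r - r +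
log(1+r)`, whose maximum over `r` is at most `-s - log(1-s) ≤ 2s²`. -/
theorem conjugate_gradient_add_le (hC : IsCompact C) {x δ : Vec n} (hx : x ∈ interior C) {s : ℝ}
    (hs : s ≤ 1 / 2) (hδ : ∀ h, inner ℝ δ h ≤ s * √(quad Ψ x h)) :
    conjugate C Ψ (gradient Ψ x + δ) ≤
      conjugate C Ψ (gradient Ψ x) + inner ℝ δ x + 2 * s ^ 2 := by
  have : Nonempty (interior C) := ⟨⟨x, hx⟩⟩
  rw [hΨ.conjugate_gradient hC hx]
  refine ciSup_le ?_
  rintro ⟨y, hy⟩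
  show inner ℝ _ y - Ψ y ≤ _
  have e : x + (y - x) = y := by abel
  have h1 := hΨ.toIsSelfConcordant.add_fderiv_add_le (h := y - x) hx (by rwa [e])
  rw [e, ← inner_gradient, inner_sub_right] at h1
  have h2 := hδ (y - x)
  set r := √(quad Ψ x (y - x))
  have hr : 0 ≤ r := Real.sqrt_nonneg _
  rw [inner_sub_right] at h2
  rw [inner_add_left]
  have h1r : 0 < 1 + r := by linarith
  have h1s : 0 < 1 - s := by linarith
  have h3 := Real.log_le_sub_one_of_pos (mul_pos h1r h1s)
  rw [Real.log_mul h1r.ne' h1s.ne'] at h3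
  have h4 := Real.one_sub_inv_le_log_of_pos h1s
  have h5 : (1 - s)⁻¹ ≤ 1 + s + 2 * s ^ 2 := by
    rw [inv_le_iff_one_le_mul₀ h1s]
    nlinarith [mul_nonneg (sq_nonneg s) (by linarith : 0 ≤ 1 - 2 * s)]
  nlinarith

theorem exists_norm_le_sqrt_quad (hC : IsCompact C) {x : Vec n} (hx : x ∈ interior C) :
    ∃ κ > 0, ∀ h, ‖h‖ ≤ κ * √(quad Ψ x h) := by
  have hcont : Continuous (quad Ψ x) := by
    have : quad Ψ x = fun h => inner ℝ (hessian Ψ x h) h := funext (quad_eq_inner_hessian x)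
    rw [this]; fun_prop
  obtain ⟨m, hm, hle⟩ := (isCompact_sphere (0 : Vec n) 1).exists_forall_le' hcont.continuousOn
    (a := 0) (fun h hh => hΨ.quad_pos hC hx (fun h0 => by simp [h0] at hh))
  have hsm := Real.sqrt_pos.2 hm
  refine ⟨(√m)⁻¹, inv_pos.2 hsm, fun h => ?_⟩
  rcases eq_or_ne h 0 with rfl | hh
  · simpa using mul_nonneg (inv_pos.2 hsm).le (Real.sqrt_nonneg _)
  have hpos := norm_pos_iff.2 hh
  have h1 := hle (‖h‖⁻¹ • h) (by simp [norm_smul, hpos.ne'])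
  rw [quad_smul, inv_pow, ← div_eq_inv_mul, le_div_iff₀ (by positivity)] at h1
  rw [← div_eq_inv_mul, le_div_iff₀ hsm]
  refine Real.le_sqrt_of_sq_le ?_
  rw [mul_pow, Real.sq_sqrt hm.le]
  linarith

/-- The Fenchel–Young lower bound and the stability upper bound differ by a quadratic in `δ`, which
forces differentiability with gradient `x`. -/
theorem hasGradientAt_conjugate (hC : IsCompact C) {x : Vec n} (hx : x ∈ interior C) :
    HasGradientAt (conjugate C Ψ) x (gradient Ψ x) := by
  obtain ⟨κ, hκ, hle⟩ := hΨ.exists_norm_le_sqrt_quad hC hx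
  rw [hasGradientAt_iff_isLittleO_nhds_zero]
  refine Asymptotics.IsBigO.trans_isLittleO (g := fun δ : Vec n => ‖δ‖ ^ 2) ?_
    (Asymptotics.isLittleO_norm_pow_id one_lt_two)
  refine Asymptotics.IsBigO.of_bound (2 * κ ^ 2) ?_
  filter_upwards [Metric.ball_mem_nhds (0 : Vec n) (by positivity : 0 < 1 / (2 * κ))] with δ hδ
  rw [mem_ball_zero_iff, lt_div_iff₀ (by positivity)] at hδ
  have h1 := hΨ.conjugate_gradient_add_le hC hx (s := ‖δ‖ * κ) (by linarith)
    (δ := δ) (fun h => by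
      refine (real_inner_le_norm δ h).trans ?_
      rw [mul_assoc]
      exact mul_le_mul_of_nonneg_left (hle h) (norm_nonneg _))
  have h2 := hΨ.le_conjugate hC hx (gradient Ψ x + δ)
  rw [inner_add_left] at h2
  rw [hΨ.conjugate_gradient hC hx] at h1 ⊢
  rw [real_inner_comm δ x]
  rw [Real.norm_eq_abs, Real.norm_eq_abs, abs_of_nonneg (by positivity : 0 ≤ ‖δ‖ ^ 2), abs_le]
  constructor <;> nlinarith [sq_nonneg (‖δ‖ * κ)]

theorem mirror_gradient (hC : IsCompact C) {x : Vec n} (hx : x ∈ interior C) :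
    mirror C Ψ (gradient Ψ x) = x :=
  (hΨ.hasGradientAt_conjugate hC hx).gradient

theorem mirror_mem (hC : IsCompact C) (hne : (interior C).Nonempty) (θ : Vec n) :
    mirror C Ψ θ ∈ interior C := by
  obtain ⟨x, hx, rfl⟩ := hΨ.exists_gradient_eq hC hne θ
  rwa [hΨ.mirror_gradient hC hx]

theorem gradient_mirror (hC : IsCompact C) (hne : (interior C).Nonempty) (θ : Vec n) :
    gradient Ψ (mirror C Ψ θ) = θ := by
  obtain ⟨x, hx, rfl⟩ := hΨ.exists_gradient_eq hC hne θ
  rw [hΨ.mirror_gradient hC hx]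

end IsSelfConcordantBarrier

end

section

/-! ### The greedy allocation -/

section Greedy

variable {v : ℕ → ℝ} {arr : ℕ → Prop} [DecidablePred arr] {σ : ℝ}

theorem need_succ (s : ℕ) : need v arr σ (s + 1) = need v arr σ s - take v arr σ s := rfl

theorem need_nonneg (hσ : 0 ≤ σ) (s : ℕ) : 0 ≤ need v arr σ s := by
  induction s with
  | zero => exact hσ
  | succ s ih =>
    rw [need_succ, take]
    split_ifs
    · linarith [min_le_right (v s) (need v arr σ s)]
    · simpa using ih

theorem take_nonneg (hσ : 0 ≤ σ) {s : ℕ} (hv : 0 ≤ v s) : 0 ≤ take v arr σ s := by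
  rw [take]
  split_ifs
  · exact le_min hv (need_nonneg hσ s)
  · exact le_rfl

theorem take_le {s : ℕ} (hv : 0 ≤ v s) : take v arr σ s ≤ v s := by
  rw [take]
  split_ifs
  · exact min_le_left _ _
  · exact hv

theorem sum_take_add_need (t : ℕ) :
    ∑ s ∈ Finset.range t, take v arr σ s + need v arr σ t = σ := by
  induction t with
  | zero => simp [need]
  | succ t ih => rw [Finset.sum_range_succ, need_succ]; linarith

theorem need_eq_zero_of_take_lt {s : ℕ} (hs : arr s) (h : take v arr σ s < v s) :
    need v arr σ (s + 1) = 0 := by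
  rw [need_succ]
  rw [take, if_pos hs] at h ⊢
  rcases min_choice (v s) (need v arr σ s) with h1 | h1
  · rw [h1] at h; exact absurd h (lt_irrefl _)
  · rw [h1, sub_self]

theorem need_antitone (hσ : 0 ≤ σ) (hv : ∀ s, 0 ≤ v s) : Antitone (need v arr σ) :=
  antitone_nat_of_succ_le fun s => by
    rw [need_succ]; linarith [take_nonneg (arr := arr) hσ (hv s)]

/-- An arrived account that is not emptied has met the entire remaining need, which then stays zero.
-/
theorem take_eq_of_need_pos (hσ : 0 ≤ σ) (hv : ∀ s, 0 ≤ v s) {s t : ℕ} (hst : s < t)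
    (hs : arr s) (ht : 0 < need v arr σ t) : take v arr σ s = v s := by
  refine le_antisymm (take_le (hv s)) (not_lt.1 fun h => ?_)
  have h1 := need_antitone (arr := arr) hσ hv (Nat.succ_le_of_lt hst)
  rw [Nat.succ_eq_add_one, need_eq_zero_of_take_lt hs h] at h1
  linarith

end Greedy

/-! ### The bank -/

section Bank

variable {σ : ℕ → ℝ} {d : ℕ → ℕ}

theorem savings_nonneg (hσ : ∀ t, 0 ≤ σ t) (t s : ℕ) : 0 ≤ savings σ d t s := by
  induction t generalizing s with
  | zero => exact le_rfl
  | succ t ih =>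
    rw [savings]
    split_ifs
    · exact hσ t
    · linarith [take_le (arr := Arrived d t) (σ := σ t) (ih s)]

theorem savings_le (hσ : ∀ t, 0 ≤ σ t) {t s : ℕ} (hst : s < t) : savings σ d t s ≤ σ s := by
  induction t with
  | zero => omega
  | succ t ih =>
    rw [savings]
    split_ifs with h
    · rw [h]
    · have := take_nonneg (arr := Arrived d t) (hσ t) (savings_nonneg (d := d) hσ t s)
      linarith [ih (by omega)]

theorem spend_nonneg (hσ : ∀ t, 0 ≤ σ t) (t s : ℕ) : 0 ≤ spend σ d t s :=
  take_nonneg (hσ t) (savings_nonneg hσ t s)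

theorem invest_nonneg (hσ : ∀ t, 0 ≤ σ t) (t : ℕ) : 0 ≤ invest σ d t := need_nonneg (hσ t) t

theorem sum_spend_add_invest (t : ℕ) :
    ∑ s ∈ Finset.range t, spend σ d t s + invest σ d t = σ t := sum_take_add_need t

/-- Bookkeeping with a price `w s` on each account: withdrawals are deposits minus the remaining
balance. -/
theorem sum_spend_mul_eq {w : ℕ → ℝ} (T : ℕ) :
    ∑ t ∈ Finset.range T, ∑ s ∈ Finset.range t, spend σ d t s * w s =
      ∑ s ∈ Finset.range T, σ s * w s - ∑ s ∈ Finset.range T, savings σ d T s * w s := by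
  induction T with
  | zero => simp
  | succ T ih =>
    rw [Finset.sum_range_succ, ih, Finset.sum_range_succ, Finset.sum_range_succ]
    have h1 : savings σ d (T + 1) T = σ T := by rw [savings, if_pos rfl]
    have h2 : ∑ s ∈ Finset.range T, savings σ d (T + 1) s * w s =
        ∑ s ∈ Finset.range T, (savings σ d T s * w s - spend σ d T s * w s) := by
      refine Finset.sum_congr rfl fun s hs => ?_
      rw [savings, if_neg (Finset.mem_range.1 hs).ne, spend]
      ring
    rw [h1, h2, Finset.sum_sub_distrib]
    ring

theorem sum_invest_eq_sum_savings (T : ℕ) :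
    ∑ t ∈ Finset.range T, invest σ d t = ∑ s ∈ Finset.range T, savings σ d T s := by
  induction T with
  | zero => simp
  | succ T ih =>
    rw [Finset.sum_range_succ, Finset.sum_range_succ, ih]
    have h1 : savings σ d (T + 1) T = σ T := by rw [savings, if_pos rfl]
    have h2 : ∑ s ∈ Finset.range T, savings σ d (T + 1) s =
        ∑ s ∈ Finset.range T, (savings σ d T s - spend σ d T s) := by
      refine Finset.sum_congr rfl fun s hs => ?_
      rw [savings, if_neg (Finset.mem_range.1 hs).ne, spend]
    rw [h1, h2, Finset.sum_sub_distrib]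
    linarith [sum_spend_add_invest (σ := σ) (d := d) T]

/-- Total investment equals the total balance. A round that invests has emptied every arrived
account, leaving only its own scale and the unarrived ones; other rounds do not change the total. -/
theorem sum_invest_le (hσ : ∀ t, 0 ≤ σ t) {M : ℝ} (hM : 0 ≤ M) (T : ℕ)
    (h : ∀ t < T, σ t + ∑ s ∈ (Finset.range t).filter (fun s => ¬ Arrived d t s), σ s ≤ M) :
    ∑ t ∈ Finset.range T, invest σ d t ≤ M := by
  induction T with
  | zero => simpa using hM
  | succ T ih =>
    rcases (invest_nonneg (d := d) hσ T).eq_or_lt with h0 | hpos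
    · rw [Finset.sum_range_succ, ← h0, add_zero]
      exact ih fun t ht => h t (by omega)
    · rw [sum_invest_eq_sum_savings, Finset.sum_range_succ, savings, if_pos rfl, add_comm]
      refine le_trans (add_le_add le_rfl ?_) (h T (by omega))
      rw [Finset.sum_filter]
      refine Finset.sum_le_sum fun s hs => ?_
      have hs := Finset.mem_range.1 hs
      rw [savings, if_neg hs.ne]
      by_cases ha : Arrived d T s
      · rw [take_eq_of_need_pos (hσ T) (savings_nonneg hσ T) hs ha hpos]
        simp [ha]
      · rw [if_pos ha, take, if_neg ha, sub_zero]
        exact savings_le hσ hs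

end Bank

/-! ### Counting missing feedback -/

theorem sum_card_filter_lt {M : Type*} [AddCommMonoid M] (f : ℕ → M) (W : Finset ℕ) :
    ∑ s ∈ W, f (W.filter (· < s)).card = ∑ j ∈ Finset.range W.card, f j := by
  induction W using Finset.induction_on_max with
  | empty => simp
  | insert a W ha ih =>
    have haW : a ∉ W := fun h => lt_irrefl _ (ha a h)
    rw [Finset.sum_insert haW, Finset.card_insert_of_notMem haW, Finset.sum_range_succ, ← ih,
      add_comm]
    congr 1
    · refine Finset.sum_congr rfl fun s hs => ?_
      rw [Finset.filter_insert, if_neg (not_lt.2 (ha s hs).le)]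
    · rw [Finset.filter_insert, if_neg (lt_irrefl _), Finset.filter_true_of_mem ha]

/-- Feedback of `r < s` that is still missing at time `t ≥ s` was also missing at time `s`. -/
theorem card_filter_le_missing {d : ℕ → ℕ} {t : ℕ} {W : Finset ℕ}
    (hW : ∀ s ∈ W, s ≤ t ∧ (s < t → ¬ Arrived d t s)) {s : ℕ} (hs : s ∈ W) :
    (W.filter (· < s)).card ≤ missing d s := by
  refine Finset.card_le_card fun r hr => ?_
  rw [Finset.mem_filter] at hr
  have h1 := hW r hr.1
  have h2 := (hW s hs).1
  have h3 := h1.2 (by omega)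
  simp only [Arrived, not_lt, Finset.mem_filter, Finset.mem_range] at h3 ⊢
  omega

theorem missing_le (d : ℕ → ℕ) (t : ℕ) : missing d t ≤ t :=
  (Finset.card_filter_le _ _).trans (by simp)

theorem cumMissing_mono (d : ℕ → ℕ) : Monotone (cumMissing d) := fun _ _ h =>
  Finset.sum_le_sum_of_subset (Finset.range_subset_range.2 (by omega))

theorem missing_le_cumMissing (d : ℕ → ℕ) (t : ℕ) : missing d t ≤ cumMissing d t :=
  Finset.single_le_sum (f := missing d) (fun _ _ => Nat.zero_le _)
    (Finset.mem_range.2 (Nat.lt_succ_self t))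

/-- Double counting of the pairs `s < t ≤ s + d s`. -/
theorem sum_missing_le (d : ℕ → ℕ) (T : ℕ) :
    ∑ t ∈ Finset.range T, missing d t ≤ ∑ t ∈ Finset.range T, d t := by
  have h1 : ∀ t ∈ Finset.range T, missing d t =
      ∑ s ∈ Finset.range T, if s < t ∧ t ≤ s + d s then 1 else 0 := fun t ht => by
    rw [← Finset.card_filter, missing]
    congr 1
    ext s
    simp only [Arrived, not_lt, Finset.mem_filter, Finset.mem_range] at ht ⊢
    omega
  rw [Finset.sum_congr rfl h1, Finset.sum_comm]
  refine Finset.sum_le_sum fun s _ => ?_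
  rw [← Finset.card_filter]
  calc _ ≤ (Finset.Ioc s (s + d s)).card := Finset.card_le_card fun t ht => by
        simp only [Finset.mem_filter, Finset.mem_Ioc] at ht ⊢; omega
    _ = d s := by simp

theorem cumMissing_le {d : ℕ → ℕ} {t T : ℕ} (ht : t < T) :
    cumMissing d t ≤ ∑ t ∈ Finset.range T, d t :=
  (Finset.sum_le_sum_of_subset (Finset.range_subset_range.2 (by omega))).trans (sum_missing_le d T)

/-- The rounds whose feedback is missing at the beginning of round `t`, together with `t`. -/
def pending (d : ℕ → ℕ) (t : ℕ) : Finset ℕ :=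
  insert t ((Finset.range t).filter fun s => ¬ Arrived d t s)

theorem card_pending (d : ℕ → ℕ) (t : ℕ) : (pending d t).card = missing d t + 1 :=
  Finset.card_insert_of_notMem (by simp)

theorem card_filter_pending_le {d : ℕ → ℕ} {t s : ℕ} (hs : s ∈ pending d t) :
    ((pending d t).filter (· < s)).card ≤ missing d s := by
  refine card_filter_le_missing (t := t) (fun r hr => ?_) hs
  simp only [pending, Finset.mem_insert, Finset.mem_filter, Finset.mem_range] at hr
  rcases hr with rfl | hr
  · exact ⟨le_rfl, fun h => absurd h (lt_irrefl _)⟩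
  · exact ⟨hr.1.le, fun _ => hr.2⟩

theorem le_of_mem_pending {d : ℕ → ℕ} {t s : ℕ} (hs : s ∈ pending d t) : s ≤ t := by
  simp only [pending, Finset.mem_insert, Finset.mem_filter, Finset.mem_range] at hs
  omega

/-- The pending rounds have ranks `0, …, m` with `m = missing d t`, and each rank is at most the
number missing in that round, so `m(m+1)/2 ≤ 𝔇_t`. -/
theorem missing_sq_le (d : ℕ → ℕ) (t : ℕ) : missing d t ^ 2 ≤ 2 * cumMissing d t := by
  have h1 : ∑ s ∈ pending d t, ((pending d t).filter (· < s)).card ≤ cumMissing d t := by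
    refine (Finset.sum_le_sum fun s hs => card_filter_pending_le hs).trans ?_
    exact Finset.sum_le_sum_of_subset fun s hs =>
      Finset.mem_range.2 (Nat.lt_succ_of_le (le_of_mem_pending hs))
  have h2 := sum_card_filter_lt (fun j => j) (pending d t)
  rw [card_pending] at h2
  have h3 := Finset.sum_range_id_mul_two (missing d t + 1)
  simp only [add_tsub_cancel_right] at h3
  nlinarith

end

section

/-! ### Bounds on the action scales -/

theorem sum_div_sqrt_le {a : ℕ → ℝ} (ha : ∀ t, 0 ≤ a t) (T : ℕ) :
    ∑ t ∈ Finset.range T, a t / √(∑ s ∈ Finset.range (t + 1), a s) ≤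
      2 * √(∑ t ∈ Finset.range T, a t) := by
  induction T with
  | zero => simp
  | succ T ih =>
    rw [Finset.sum_range_succ]
    have hY : 0 ≤ ∑ s ∈ Finset.range T, a s := Finset.sum_nonneg fun s _ => ha s
    have hX : ∑ s ∈ Finset.range (T + 1), a s = ∑ s ∈ Finset.range T, a s + a T :=
      Finset.sum_range_succ _ _
    set X := ∑ s ∈ Finset.range (T + 1), a s
    set Y := ∑ s ∈ Finset.range T, a s
    have hX0 : 0 ≤ X := by linarith [ha T]
    suffices a T / √X ≤ 2 * (√X - √Y) by linarith
    have hle : √Y ≤ √X := Real.sqrt_le_sqrt (by linarith [ha T])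
    have hY1 := Real.mul_self_sqrt hY
    have hX1 := Real.mul_self_sqrt hX0
    refine div_le_of_le_mul₀ (Real.sqrt_nonneg _) (by linarith) ?_
    nlinarith [Real.sqrt_nonneg Y, mul_nonneg (sub_nonneg.2 hle) (sub_nonneg.2 hle)]

/-- The reciprocal of the action scale before it is capped by `8n`. -/
def rate (n T : ℕ) (d : ℕ → ℕ) (t : ℕ) : ℝ :=
  √(Real.log T / (n * (t + 1 : ℝ))) +
    missing d t *
      √(Real.log ((cumMissing d t : ℝ) + 1) * Real.log T / (n * (cumMissing d t : ℝ)))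

theorem scale_eq (n T : ℕ) (d : ℕ → ℕ) (t : ℕ) :
    scale n T d t = max (rate n T d t)⁻¹ (8 * n) := rfl

theorem le_scale (n T : ℕ) (d : ℕ → ℕ) (t : ℕ) : 8 * (n : ℝ) ≤ scale n T d t := le_max_right _ _

theorem scale_nonneg (n T : ℕ) (d : ℕ → ℕ) (t : ℕ) : 0 ≤ scale n T d t :=
  le_trans (by positivity) (le_scale n T d t)

theorem scale_pos {n : ℕ} (hn : 1 ≤ n) (T : ℕ) (d : ℕ → ℕ) (t : ℕ) : 0 < scale n T d t := by
  have : (0 : ℝ) < n := by exact_mod_cast hn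
  exact lt_of_lt_of_le (by positivity) (le_scale n T d t)

theorem half_le_log {x : ℝ} (hx : 2 ≤ x) : 1 / 2 ≤ Real.log x := by
  have := Real.log_le_log (by norm_num) hx
  linarith [Real.log_two_gt_d9]

section

variable {n T : ℕ} (hn : 1 ≤ n) (hT : 2 ≤ T) (d : ℕ → ℕ)
include hn hT

theorem rate_pos (t : ℕ) : 0 < rate n T d t := by
  have hn' : (0 : ℝ) < n := by exact_mod_cast hn
  have hL := half_le_log (x := T) (by exact_mod_cast hT)
  refine add_pos_of_pos_of_nonneg (Real.sqrt_pos.2 ?_)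
    (mul_nonneg (Nat.cast_nonneg _) (Real.sqrt_nonneg _))
  have : 0 < Real.log T := by linarith
  positivity

theorem inv_scale_le (t : ℕ) : (scale n T d t)⁻¹ ≤ rate n T d t := by
  have hr := rate_pos hn hT d t
  rw [scale_eq]
  exact inv_le_of_inv_le₀ hr (le_max_left _ _)

theorem scale_le_of_missing_zero {s : ℕ} (hs : s < T) :
    scale n T d s ≤ 8 * n + √(2 * (n * T)) := by
  have hn' : (0 : ℝ) < n := by exact_mod_cast hn
  have hT' : (2 : ℝ) ≤ T := by exact_mod_cast hT
  have hsT : (s : ℝ) + 1 ≤ T := by exact_mod_cast hs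
  have hL := half_le_log hT'
  have h1 : (√(2 * (n * T)))⁻¹ ≤ rate n T d s := by
    refine le_trans ?_ (le_add_of_nonneg_right (mul_nonneg (Nat.cast_nonneg _) (Real.sqrt_nonneg _)))
    rw [← Real.sqrt_inv]
    refine Real.sqrt_le_sqrt ?_
    rw [mul_inv, ← one_div, ← div_eq_mul_inv]
    gcongr
  have h2 : (rate n T d s)⁻¹ ≤ √(2 * (n * T)) := inv_le_of_inv_le₀ (by positivity) h1
  rw [scale_eq]
  exact max_le (by linarith) (by linarith [Real.sqrt_nonneg (2 * ((n : ℝ) * T))])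

/-- Only the delay part of `rate` is kept. Both logarithms are at least `1/2`, which gives the
factor `2`. -/
theorem scale_le_of_le_missing {s t j : ℕ} (hst : s ≤ t) (hj : 1 ≤ j)
    (hjs : j ≤ missing d s) :
    scale n T d s ≤ 8 * n + 2 * √(n * cumMissing d t) * (j : ℝ)⁻¹ := by
  have hn' : (0 : ℝ) < n := by exact_mod_cast hn
  have hj' : (0 : ℝ) < j := by exact_mod_cast hj
  have hL := half_le_log (x := T) (by exact_mod_cast hT)
  have hc1 : (1 : ℝ) ≤ cumMissing d s := by
    exact_mod_cast hj.trans (hjs.trans (missing_le_cumMissing d s))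
  have hct : (cumMissing d s : ℝ) ≤ cumMissing d t := by exact_mod_cast cumMissing_mono d hst
  have hc0 : (0 : ℝ) < cumMissing d t := by linarith
  have hL2 := half_le_log (x := (cumMissing d s : ℝ) + 1) (by linarith)
  have h4 : (1 / 2 : ℝ) * (1 / 2) ≤ Real.log ((cumMissing d s : ℝ) + 1) * Real.log T :=
    mul_le_mul hL2 hL (by norm_num) (by linarith)
  have h1 : (2 * √(n * cumMissing d t) * (j : ℝ)⁻¹)⁻¹ ≤ rate n T d s := by
    refine le_trans ?_ (le_add_of_nonneg_left (Real.sqrt_nonneg _))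
    have e : (2 * √(n * cumMissing d t) * (j : ℝ)⁻¹)⁻¹ =
        j * √((1 / 2 * (1 / 2)) / (n * cumMissing d t)) := by
      rw [Real.sqrt_div (by norm_num), Real.sqrt_mul_self (by norm_num)]
      field_simp
    rw [e]
    refine mul_le_mul (by exact_mod_cast hjs) (Real.sqrt_le_sqrt ?_) (Real.sqrt_nonneg _)
      (Nat.cast_nonneg _)
    have : (0 : ℝ) < cumMissing d s := by linarith
    gcongr
  have h2 : (rate n T d s)⁻¹ ≤ 2 * √(n * cumMissing d t) * (j : ℝ)⁻¹ :=
    inv_le_of_inv_le₀ (by positivity) h1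
  rw [scale_eq]
  exact max_le (by linarith) (le_add_of_nonneg_right (by positivity))

theorem sum_pending_scale_le {t : ℕ} (ht : t < T) :
    ∑ s ∈ pending d t, scale n T d s ≤ (missing d t + 1) * (8 * n) +
      (√(2 * (n * T)) + 2 * √(n * cumMissing d t) * (1 + Real.log T)) := by
  -- Bound by rank among the pending rounds: rank `0` has only the horizon term, and rank `j ≥ 1`
  -- contributes to a harmonic sum.
  set f : ℕ → ℝ := fun j => if j = 0 then √(2 * (n * T)) else
    2 * √(n * cumMissing d t) * (j : ℝ)⁻¹ with hf
  have h1 : ∀ s ∈ pending d t,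
      scale n T d s ≤ 8 * n + f ((pending d t).filter (· < s)).card := fun s hs => by
    have hst := le_of_mem_pending hs
    have hj := card_filter_pending_le hs
    rw [hf]
    dsimp only
    split_ifs with h0
    · exact scale_le_of_missing_zero hn hT d (by omega)
    · exact scale_le_of_le_missing hn hT d hst (by omega) hj
  refine (Finset.sum_le_sum h1).trans ?_
  rw [Finset.sum_add_distrib, sum_card_filter_lt, Finset.sum_const, card_pending, nsmul_eq_mul,
    Finset.sum_range_succ']
  push_cast
  have h2 : ∑ j ∈ Finset.range (missing d t), f (j + 1) =
      2 * √(n * cumMissing d t) * harmonic (missing d t) := by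
    rw [harmonic]
    push_cast
    rw [Finset.mul_sum]
    exact Finset.sum_congr rfl fun j _ => by simp [hf]
  have h3 : (harmonic (missing d t) : ℝ) ≤ 1 + Real.log T := by
    refine (harmonic_le_one_add_log _).trans (add_le_add_right ?_ 1)
    rcases (missing d t).eq_zero_or_pos with h0 | h0
    · rw [h0]; simpa using Real.log_natCast_nonneg T
    · exact Real.log_le_log (by exact_mod_cast h0)
        (by exact_mod_cast (missing_le d t).trans ht.le)
  have h4 : f 0 = √(2 * (n * T)) := by simp [hf]
  rw [h2, h4]
  have h5 : 0 ≤ 2 * √((n : ℝ) * cumMissing d t) := by positivity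
  nlinarith [mul_le_mul_of_nonneg_left h3 h5]

theorem sum_pending_scale_le' (hnT : n ≤ T) {t : ℕ} (ht : t < T) :
    ∑ s ∈ pending d t, scale n T d s ≤ 10 * (√n * √T) +
      20 * Real.log (T + 1) * (n * √((∑ t ∈ Finset.range T, d t : ℕ) : ℝ)) := by
  refine (sum_pending_scale_le hn hT d ht).trans ?_
  set D : ℝ := ((∑ t ∈ Finset.range T, d t : ℕ) : ℝ)
  have hn' : (1 : ℝ) ≤ n := by exact_mod_cast hn
  have hT' : (2 : ℝ) ≤ T := by exact_mod_cast hT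
  have hcD : (cumMissing d t : ℝ) ≤ D := Nat.cast_le.2 (cumMissing_le ht)
  have hD : 0 ≤ D := Nat.cast_nonneg _
  have hl1 : 1 ≤ Real.log (T + 1) := by
    rw [Real.le_log_iff_exp_le (by linarith)]
    linarith [Real.exp_one_lt_d9]
  have hlT : Real.log T ≤ Real.log (T + 1) := Real.log_le_log (by linarith) (by linarith)
  have hm : (missing d t : ℝ) ≤ 2 * √D := by
    have h1 : (missing d t : ℝ) ^ 2 ≤ 2 * cumMissing d t := by exact_mod_cast missing_sq_le d t
    refine abs_le_of_sq_le_sq' ?_ (by positivity) |>.2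
    rw [mul_pow, Real.sq_sqrt hD]
    linarith
  -- The only use of `n ≤ T`: it absorbs the floor `8n` of the current round into `√(nT)`.
  have hnn : (n : ℝ) ≤ √n * √T := by
    rw [← Real.sqrt_mul (by linarith)]
    refine Real.le_sqrt_of_sq_le ?_
    rw [sq]
    gcongr
  have h2 : √(2 * (n * T)) ≤ 2 * (√n * √(T : ℝ)) := by
    rw [← Real.sqrt_mul (by linarith)]
    refine Real.sqrt_le_iff.2 ⟨by positivity, ?_⟩
    rw [mul_pow, Real.sq_sqrt (by positivity)]
    nlinarith [mul_pos (by linarith : (0 : ℝ) < n) (by linarith : (0 : ℝ) < T)]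
  have h3 : √(n * cumMissing d t) ≤ n * √D := by
    rw [Real.sqrt_mul (by linarith)]
    refine mul_le_mul (Real.sqrt_le_iff.2 ⟨by linarith, by nlinarith⟩) (Real.sqrt_le_sqrt hcD)
      (Real.sqrt_nonneg _) (by linarith)
  have hDs := Real.sqrt_nonneg D
  have h4 : 2 * √(n * cumMissing d t) * (1 + Real.log T) ≤
      2 * (n * √D) * (2 * Real.log (T + 1)) := by
    refine mul_le_mul (by linarith) (by linarith) ?_ (by positivity)
    linarith [half_le_log hT']
  have h5 : (missing d t : ℝ) * (8 * n) ≤ 2 * √D * (8 * n) :=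
    mul_le_mul_of_nonneg_right hm (by positivity)
  have h6 : 0 ≤ n * √D := by positivity
  nlinarith [mul_le_mul_of_nonneg_right hl1 h6]

theorem sum_inv_scale_le :
    (n : ℝ) ^ 2 * ∑ t ∈ Finset.range T, (scale n T d t)⁻¹ ≤
      4 * Real.log (T + 1) * (n * √n * √T +
        (n : ℝ) ^ 2 * √((∑ t ∈ Finset.range T, d t : ℕ) : ℝ)) := by
  set D : ℝ := ((∑ t ∈ Finset.range T, d t : ℕ) : ℝ)
  have hn' : (1 : ℝ) ≤ n := by exact_mod_cast hn
  have hT' : (2 : ℝ) ≤ T := by exact_mod_cast hT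
  set ℓ := Real.log (T + 1)
  have hl1 : 1 ≤ ℓ := by
    rw [Real.le_log_iff_exp_le (by linarith)]
    linarith [Real.exp_one_lt_d9]
  have hlT : Real.log T ≤ ℓ := Real.log_le_log (by linarith) (by linarith)
  have hlT0 : 0 ≤ Real.log T := by linarith [half_le_log hT']
  have hsn : 0 < √(n : ℝ) := Real.sqrt_pos.2 (by linarith)
  have hA : ∑ t ∈ Finset.range T, 1 / √((t : ℝ) + 1) ≤ 2 * √T := by
    simpa using sum_div_sqrt_le (a := fun _ => 1) (fun _ => zero_le_one) T
  have hB : ∑ t ∈ Finset.range T, (missing d t : ℝ) / √(cumMissing d t) ≤ 2 * √D := by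
    have h1 := sum_div_sqrt_le (a := fun t => (missing d t : ℝ)) (fun _ => Nat.cast_nonneg _) T
    have h2 : ((∑ t ∈ Finset.range T, missing d t : ℕ) : ℝ) ≤ D :=
      Nat.cast_le.2 (sum_missing_le d T)
    simp only [cumMissing]
    push_cast at h2 ⊢
    refine h1.trans ?_
    gcongr
  have hle : ∀ t ∈ Finset.range T, (scale n T d t)⁻¹ ≤
      ℓ / √n * (1 / √((t : ℝ) + 1)) + 2 * ℓ / √n * ((missing d t : ℝ) / √(cumMissing d t)) := by
    intro t ht
    have ht := Finset.mem_range.1 ht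
    refine (inv_scale_le hn hT d t).trans (add_le_add ?_ ?_)
    · rw [Real.sqrt_div hlT0, Real.sqrt_mul (by linarith), div_mul_div_comm, mul_one]
      gcongr
      refine Real.sqrt_le_iff.2 ⟨by linarith, by nlinarith⟩
    · have hc : Real.log ((cumMissing d t : ℝ) + 1) ≤ 2 * ℓ := by
        have h1 : cumMissing d t ≤ T * T := by
          refine (Finset.sum_le_card_nsmul _ _ T fun s hs => ?_).trans ?_
          · exact (missing_le d s).trans (by have := Finset.mem_range.1 hs; omega)
          · rw [Finset.card_range, smul_eq_mul]; gcongr; omega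
        have h2 : (cumMissing d t : ℝ) ≤ T * T := by exact_mod_cast h1
        have h3 : 2 * ℓ = Real.log ((T + 1) ^ 2) := by rw [Real.log_pow]; push_cast; rfl
        rw [h3]
        exact Real.log_le_log (by positivity) (by nlinarith)
      have hc0 : 0 ≤ Real.log ((cumMissing d t : ℝ) + 1) :=
        Real.log_nonneg (le_add_of_nonneg_left (Nat.cast_nonneg _))
      rw [Real.sqrt_div (mul_nonneg hc0 hlT0), Real.sqrt_mul (Nat.cast_nonneg n)]
      have h4 : √(Real.log ((cumMissing d t : ℝ) + 1) * Real.log T) ≤ 2 * ℓ := by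
        refine Real.sqrt_le_iff.2 ⟨by linarith, ?_⟩
        nlinarith [mul_le_mul hc hlT hlT0 (by linarith)]
      have e : 2 * ℓ / √(n : ℝ) * ((missing d t : ℝ) / √(cumMissing d t)) =
        missing d t * (2 * ℓ / (√n * √(cumMissing d t))) := by
        rw [div_mul_div_comm, mul_comm (2 * ℓ), mul_div_assoc]
      rw [e]
      gcongr
  have hsum := Finset.sum_le_sum hle
  rw [Finset.sum_add_distrib, ← Finset.mul_sum, ← Finset.mul_sum] at hsum
  have h1 : ∑ t ∈ Finset.range T, (scale n T d t)⁻¹ ≤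
      ℓ / √n * (2 * √T) + 2 * ℓ / √n * (2 * √D) := by
    refine hsum.trans ?_
    gcongr
  have hss : √(n : ℝ) * √n = n := Real.mul_self_sqrt (by linarith)
  have h1s : √(n : ℝ) ≤ n := Real.sqrt_le_iff.2 ⟨by linarith, by nlinarith⟩
  have hnn : (n : ℝ) ^ 2 / √n = n * √n := by
    rw [div_eq_iff hsn.ne', mul_assoc, hss, sq]
  calc (n : ℝ) ^ 2 * ∑ t ∈ Finset.range T, (scale n T d t)⁻¹
      ≤ n ^ 2 * (ℓ / √n * (2 * √T) + 2 * ℓ / √n * (2 * √D)) := by gcongr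
    _ = 2 * ℓ * ((n ^ 2 / √n) * √T) + 4 * ℓ * ((n ^ 2 / √n) * √D) := by ring
    _ = 2 * ℓ * (n * √n * √T) + 4 * ℓ * (n * √n * √D) := by rw [hnn]
    -- The delay term is weakened from `n^{3/2}` to `n²`, the order that the investment bound
    -- reaches anyway.
    _ ≤ 4 * ℓ * (n * √n * √T) + 4 * ℓ * (n * n * √D) := by gcongr; norm_num
    _ = _ := by ring

end

end

section

variable {n : ℕ} {C : Set (Vec n)} {Ψ : Vec n → ℝ} {ϑ : ℝ}

/-! ### The regret inequality of banker mirror descent -/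

theorem sum_inner_sub_le (hΨ : IsSelfConcordantBarrier C ϑ Ψ) (hC : IsCompact C)
    {σ : ℕ → ℝ} {d : ℕ → ℕ} {x g : ℕ → Vec n} {a : ℝ} (hσ : ∀ t, 0 < σ t)
    (hσa : ∀ t, a / σ t ≤ 1 / 2) (hx : ∀ t, x t ∈ interior C)
    (hθ : ∀ t, σ t • gradient Ψ (x t) = ∑ s ∈ Finset.range t,
      spend σ d t s • (gradient Ψ (x s) - (σ s)⁻¹ • g s))
    (hg : ∀ t h, |inner ℝ (g t) h| ≤ a * √(quad Ψ (x t) h)) {y : Vec n} (hy : y ∈ interior C)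
    (T : ℕ) :
    ∑ t ∈ Finset.range T, inner ℝ (g t) (x t - y) ≤
      (∑ t ∈ Finset.range T, invest σ d t) * (Ψ y + conjugate C Ψ 0) +
        2 * (a ^ 2 * ∑ t ∈ Finset.range T, (σ t)⁻¹) := by
  have hσ0 : ∀ t, 0 ≤ σ t := fun t => (hσ t).le
  set ζ : ℕ → Vec n := fun s => gradient Ψ (x s) - (σ s)⁻¹ • g s with hζ
  set B : Vec n → ℝ := fun θ => Ψ y + conjugate C Ψ θ - inner ℝ θ y with hB
  have hB0 : B 0 = Ψ y + conjugate C Ψ 0 := by simp [hB]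
  have hBnn : ∀ θ, 0 ≤ B θ := fun θ => by
    have := hΨ.le_conjugate hC hy θ
    simp only [hB]; linarith
  -- Stability: `conjugate_gradient_add_le` with `δ = -g_t/σ_t`, multiplied by `σ_t`.
  have hstab : ∀ t, inner ℝ (g t) (x t - y) ≤
      σ t * B (gradient Ψ (x t)) - σ t * B (ζ t) + 2 * (a ^ 2 * (σ t)⁻¹) := fun t => by
    have hne := (hσ t).ne'
    have h1 := hΨ.conjugate_gradient_add_le hC (hx t) (δ := -((σ t)⁻¹ • g t)) (hσa t) (fun h => by
      have h2 := (abs_le.1 (hg t h)).1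
      rw [inner_neg_left, real_inner_smul_left, div_eq_inv_mul, mul_assoc, ← mul_neg]
      exact mul_le_mul_of_nonneg_left (by linarith) (inv_pos.2 (hσ t)).le)
    rw [← sub_eq_add_neg, inner_neg_left, real_inner_smul_left] at h1
    have h3 := mul_le_mul_of_nonneg_left h1 (hσ0 t)
    have e1 : σ t * (conjugate C Ψ (gradient Ψ (x t)) + -((σ t)⁻¹ * inner ℝ (g t) (x t)) +
        2 * (a / σ t) ^ 2) = σ t * conjugate C Ψ (gradient Ψ (x t)) - inner ℝ (g t) (x t) +
        2 * (a ^ 2 * (σ t)⁻¹) := by field_simp; ring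
    have e2 : σ t * B (gradient Ψ (x t)) - σ t * B (ζ t) =
        σ t * conjugate C Ψ (gradient Ψ (x t)) - σ t * conjugate C Ψ (ζ t) -
          inner ℝ (g t) y := by
      simp only [hB, hζ, inner_sub_left, real_inner_smul_left]
      field_simp
      ring
    rw [e1] at h3
    rw [e2, inner_sub_right]
    linarith
  -- Convexity of `B` at the weighted average defining `x_t`. The default action contributes nothing
  -- to the average because `∇Ψ(x₀) = 0`, but keeps its weight in front of `B 0`.
  have hconv : ∀ t, σ t * B (gradient Ψ (x t)) ≤
      ∑ s ∈ Finset.range t, spend σ d t s * B (ζ s) + invest σ d t * B 0 := fun t => by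
    have hsum := sum_spend_add_invest (σ := σ) (d := d) t
    have hin : ∀ z, σ t * inner ℝ (gradient Ψ (x t)) z =
        ∑ s ∈ Finset.range t, spend σ d t s * inner ℝ (ζ s) z := fun z => by
      rw [← real_inner_smul_left, hθ t, sum_inner]
      exact Finset.sum_congr rfl fun s _ => real_inner_smul_left _ _ _
    have e : σ t * B (gradient Ψ (x t)) = ∑ s ∈ Finset.range t, spend σ d t s *
        (Ψ y + (inner ℝ (ζ s) (x t) - Ψ (x t)) - inner ℝ (ζ s) y) +
        invest σ d t * (Ψ y - Ψ (x t)) := by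
      have h1 : ∀ s ∈ Finset.range t, spend σ d t s *
          (Ψ y + (inner ℝ (ζ s) (x t) - Ψ (x t)) - inner ℝ (ζ s) y) =
          spend σ d t s * (Ψ y - Ψ (x t)) + (spend σ d t s * inner ℝ (ζ s) (x t) -
            spend σ d t s * inner ℝ (ζ s) y) := fun s _ => by ring
      rw [Finset.sum_congr rfl h1, Finset.sum_add_distrib, Finset.sum_sub_distrib,
        ← Finset.sum_mul, ← hin, ← hin]
      simp only [hB]
      rw [hΨ.conjugate_gradient hC (hx t)]
      linear_combination (Ψ (x t) - Ψ y) * hsum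
    rw [e]
    refine add_le_add (Finset.sum_le_sum fun s _ => ?_) ?_
    · refine mul_le_mul_of_nonneg_left ?_ (spend_nonneg hσ0 t s)
      have := hΨ.le_conjugate hC (hx t) (ζ s)
      simp only [hB]; linarith
    · refine mul_le_mul_of_nonneg_left ?_ (invest_nonneg hσ0 t)
      have := hΨ.le_conjugate hC (hx t) 0
      rw [inner_zero_left] at this
      rw [hB0]; linarith
  have h1 := Finset.sum_le_sum (s := Finset.range T) fun t _ => hstab t
  have h2 := Finset.sum_le_sum (s := Finset.range T) fun t _ => hconv t
  rw [Finset.sum_add_distrib, Finset.sum_sub_distrib, ← Finset.mul_sum, ← Finset.mul_sum] at h1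
  rw [Finset.sum_add_distrib, sum_spend_mul_eq, ← Finset.sum_mul, hB0] at h2
  have h3 : 0 ≤ ∑ s ∈ Finset.range T, savings σ d T s * B (ζ s) :=
    Finset.sum_nonneg fun s _ => mul_nonneg (savings_nonneg hσ0 T s) (hBnn _)
  linarith

/-! ### Sampling on the Dikin ellipsoid -/

theorem Draw.sign_mul_self (a : Draw n) : a.sign * a.sign = 1 := by
  rcases Int.units_eq_one_or a.2 with h | h <;> simp [Draw.sign, h]

theorem Draw.abs_sign (a : Draw n) : |a.sign| = 1 := by
  rcases Int.units_eq_one_or a.2 with h | h <;> simp [Draw.sign, h]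

namespace Frame.IsEigen

variable {F : Frame n} (hF : F.IsEigen C Ψ)
include hF

theorem quad_eq_sum (t : ℕ) {x : Vec n} (hx : x ∈ interior C) (h : Vec n) :
    quad Ψ x h = ∑ i, F.val t x i * inner ℝ (F.vec t x i) h ^ 2 := by
  rw [quad_eq_inner_hessian]
  conv_lhs => rw [← (F.vec t x).sum_repr' h, map_sum, (F.vec t x).sum_repr' h]
  rw [sum_inner]
  refine Finset.sum_congr rfl fun i _ => ?_
  rw [map_smul, hF t x hx, smul_smul, real_inner_smul_left]
  ring

theorem quad_vec (t : ℕ) {x : Vec n} (hx : x ∈ interior C) (i : Fin n) :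
    quad Ψ x (F.vec t x i) = F.val t x i := by
  rw [quad_eq_inner_hessian, hF t x hx, real_inner_smul_left, real_inner_self_eq_norm_sq,
    (F.vec t x).orthonormal.1 i]
  ring

theorem val_pos (hΨ : IsSelfConcordantBarrier C ϑ Ψ) (hC : IsCompact C) (t : ℕ) {x : Vec n}
    (hx : x ∈ interior C) (i : Fin n) : 0 < F.val t x i := by
  rw [← hF.quad_vec t hx]
  exact hΨ.quad_pos hC hx ((F.vec t x).orthonormal.ne_zero i)

theorem action_mem (hΨ : IsSelfConcordantBarrier C ϑ Ψ) (hC : IsCompact C) (t : ℕ) {x : Vec n}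
    (hx : x ∈ interior C) (a : Draw n) : action F t x a ∈ C := by
  refine hΨ.add_mem hC.isClosed hx (le_of_eq ?_)
  have hv := hF.val_pos hΨ hC t hx a.1
  rw [quad_smul, hF.quad_vec t hx, mul_pow, sq a.sign, a.sign_mul_self, inv_pow,
    Real.sq_sqrt hv.le, one_mul, inv_mul_cancel₀ hv.ne']

theorem sqrt_val_mul_le (hΨ : IsSelfConcordantBarrier C ϑ Ψ) (hC : IsCompact C) (t : ℕ)
    {x : Vec n} (hx : x ∈ interior C) (i : Fin n) (h : Vec n) :
    √(F.val t x i) * |inner ℝ (F.vec t x i) h| ≤ √(quad Ψ x h) := by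
  refine Real.le_sqrt_of_sq_le ?_
  rw [mul_pow, sq_abs, Real.sq_sqrt (hF.val_pos hΨ hC t hx i).le, hF.quad_eq_sum t hx]
  exact Finset.single_le_sum (f := fun i => F.val t x i * inner ℝ (F.vec t x i) h ^ 2)
    (fun j _ => mul_nonneg (hF.val_pos hΨ hC t hx j).le (sq_nonneg _)) (Finset.mem_univ i)

/-- The action lies in `C`, so the observed loss is at most `1`, and `√λ_i e_i` has dual local norm
at most `1`. -/
theorem abs_inner_estimator_le (hΨ : IsSelfConcordantBarrier C ϑ Ψ) (hC : IsCompact C) (t : ℕ)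
    {x : Vec n} (hx : x ∈ interior C) (a : Draw n) {l : Vec n}
    (hl : ∀ z ∈ C, |inner ℝ l z| ≤ 1) (h : Vec n) :
    |inner ℝ (estimator F t x a l) h| ≤ n * √(quad Ψ x h) := by
  have h1 := hl _ (hF.action_mem hΨ hC t hx a)
  have h2 := hF.sqrt_val_mul_le hΨ hC t hx a.1 h
  rw [estimator, real_inner_smul_left, abs_mul, abs_mul, abs_mul, abs_mul, a.abs_sign, mul_one,
    Nat.abs_cast, abs_of_nonneg (Real.sqrt_nonneg _)]
  calc |inner ℝ l (action F t x a)| * (n * √(F.val t x a.1)) * |inner ℝ (F.vec t x a.1) h|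
      = |inner ℝ l (action F t x a)| * (n * (√(F.val t x a.1) * |inner ℝ (F.vec t x a.1) h|)) := by
        ring
    _ ≤ 1 * (n * √(quad Ψ x h)) := by gcongr
    _ = _ := one_mul _

/-- Averaging over the sign centres the action at `x` and keeps only the part of the estimator
quadratic in `ε`, where the eigenvalue cancels. Summing over the orthonormal basis then recovers
`l`. -/
theorem sum_inner_action_eq (hΨ : IsSelfConcordantBarrier C ϑ Ψ) (hC : IsCompact C) (t : ℕ)
    {x : Vec n} (hx : x ∈ interior C) (l y : Vec n) :
    ∑ a : Draw n, inner ℝ l (action F t x a - y) =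
      ∑ a : Draw n, inner ℝ (estimator F t x a l) (x - y) := by
  have hu : (Finset.univ : Finset ℤˣ) = {1, -1} := rfl
  have h1 : ∀ i : Fin n, ∑ ε : ℤˣ, inner ℝ l (action F t x (i, ε) - y) =
      2 * inner ℝ l (x - y) := fun i => by
    rw [hu, Finset.sum_pair (by decide)]
    simp only [action, Draw.sign, inner_sub_right, inner_add_right, real_inner_smul_right]
    push_cast
    ring
  have h2 : ∀ i : Fin n, ∑ ε : ℤˣ, inner ℝ (estimator F t x (i, ε) l) (x - y) =
      2 * n * (inner ℝ l (F.vec t x i) * inner ℝ (F.vec t x i) (x - y)) := fun i => by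
    have hv := (Real.sqrt_pos.2 (hF.val_pos hΨ hC t hx i)).ne'
    rw [hu, Finset.sum_pair (by decide)]
    simp only [estimator, action, Draw.sign, inner_add_right, real_inner_smul_right,
      real_inner_smul_left]
    push_cast
    field_simp
    ring
  rw [Fintype.sum_prod_type, Fintype.sum_prod_type, Finset.sum_congr rfl fun i _ => h1 i,
    Finset.sum_congr rfl fun i _ => h2 i, Finset.sum_const,
    ← Finset.mul_sum, OrthonormalBasis.sum_inner_mul_inner, Finset.card_univ, Fintype.card_fin,
    nsmul_eq_mul]
  ring

end Frame.IsEigen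

/-! ### Averages over the draws -/

/-- Plays the role of conditioning on the past: `past ω t` does not involve coordinate `t`, which
can be averaged separately. -/
theorem sum_past_congr {T : ℕ} (t : Fin T) {f g : (Fin t → Draw n) → Draw n → ℝ}
    (hfg : ∀ h, ∑ a, f h a = ∑ a, g h a) :
    ∑ ω : Fin T → Draw n, f (past ω t) (ω t) = ∑ ω : Fin T → Draw n, g (past ω t) (ω t) := by
  have key : ∀ f : (Fin t → Draw n) → Draw n → ℝ,
      ∑ ω : Fin T → Draw n, f (past ω t) (ω t) =
        ∑ r : {j // j ≠ t} → Draw n, ∑ a : Draw n,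
          f (fun s => r ⟨s.castLE t.2.le, fun h => absurd (congrArg Fin.val h) s.2.ne⟩) a := by
    intro f
    rw [← (Equiv.funSplitAt t (Draw n)).symm.sum_comp, Fintype.sum_prod_type, Finset.sum_comm]
    refine Finset.sum_congr rfl fun r _ => Finset.sum_congr rfl fun a _ => ?_
    have h1 : (Equiv.funSplitAt t (Draw n)).symm (a, r) t = a := by simp [Equiv.funSplitAt]
    have h2 : past ((Equiv.funSplitAt t (Draw n)).symm (a, r)) t =
        fun s => r ⟨s.castLE t.2.le, fun h => absurd (congrArg Fin.val h) s.2.ne⟩ := by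
      funext s
      have hne : s.castLE t.2.le ≠ t := fun h => absurd (congrArg Fin.val h) s.2.ne
      simp [past, Equiv.funSplitAt, Equiv.piSplitAt, hne]
    rw [h1, h2]
  rw [key f, key g]
  exact Finset.sum_congr rfl fun r _ => hfg _

end

section

variable {n : ℕ} {C : Set (Vec n)} {Ψ : Vec n → ℝ} {ϑ : ℝ} {F : Frame n}

/-! ### The regret of Banker-BOLO -/

theorem point_mem (hΨ : IsSelfConcordantBarrier C ϑ Ψ) (hC : IsCompact C)
    (hne : (interior C).Nonempty) (T : ℕ) (l : (t : ℕ) → (Fin t → Draw n) → Vec n) (d : ℕ → ℕ)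
    (t : ℕ) (h : Fin t → Draw n) : point C Ψ F T l d t h ∈ interior C := by
  rw [point]
  exact hΨ.mirror_mem hC hne _

theorem scale_smul_gradient_point (hΨ : IsSelfConcordantBarrier C ϑ Ψ) (hC : IsCompact C)
    (hne : (interior C).Nonempty) (hn : 1 ≤ n) (T : ℕ)
    (l : (t : ℕ) → (Fin t → Draw n) → Vec n) (d : ℕ → ℕ) (w : ℕ → Draw n) (t : ℕ) :
    scale n T d t • gradient Ψ (point C Ψ F T l d t fun r => w r) =
      ∑ s ∈ Finset.range t, spend (scale n T d) d t s •
        (gradient Ψ (point C Ψ F T l d s fun r => w r) - (scale n T d s)⁻¹ •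
          estimator F s (point C Ψ F T l d s fun r => w r) (w s) (l s fun r => w r)) := by
  have hσ := (scale_pos hn T d t).ne'
  rw [point, hΨ.gradient_mirror hC hne, hΨ.gradient_mirror hC hne, smul_zero, add_zero,
    Finset.smul_sum, ← Fin.sum_univ_eq_sum_range (fun s => spend (scale n T d) d t s •
        (gradient Ψ (point C Ψ F T l d s fun r => w r) - (scale n T d s)⁻¹ •
          estimator F s (point C Ψ F T l d s fun r => w r) (w s) (l s fun r => w r)))]
  refine Finset.sum_congr rfl fun s _ => ?_
  rw [smul_smul, mul_div_cancel₀ _ hσ, mirrorStep, hΨ.gradient_mirror hC hne]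
  rfl

theorem sum_inner_estimator_le (hΨ : IsSelfConcordantBarrier C ϑ Ψ) (hC : IsCompact C)
    (hne : (interior C).Nonempty) (hn : 1 ≤ n) (hF : F.IsEigen C Ψ) (T : ℕ)
    {l : (t : ℕ) → (Fin t → Draw n) → Vec n} (hl : ∀ t h, ∀ x ∈ C, |inner ℝ (l t h) x| ≤ 1)
    (d : ℕ → ℕ) (ω : Fin T → Draw n) {y : Vec n} (hy : y ∈ interior C) :
    ∑ t : Fin T, inner ℝ (estimator F t (point C Ψ F T l d t (past ω t)) (ω t)
        (l t (past ω t))) (point C Ψ F T l d t (past ω t) - y) ≤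
      (∑ t ∈ Finset.range T, invest (scale n T d) d t) * (Ψ y - Ψ (mirror C Ψ 0)) +
        2 * ((n : ℝ) ^ 2 * ∑ t ∈ Finset.range T, (scale n T d t)⁻¹) := by
  -- The draws are extended arbitrarily beyond `T`, since the deterministic inequality concerns
  -- sequences indexed by `ℕ`.
  set w : ℕ → Draw n := fun r => if h : r < T then ω ⟨r, h⟩ else (⟨0, hn⟩, 1) with hw
  have hwω : ∀ t : Fin T, w t = ω t := fun t => by simp [hw]
  have hpast : ∀ t : Fin T, past ω t = fun r : Fin t => w r := fun t => by
    funext r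
    exact (hwω (r.castLE t.2.le)).symm
  have hn' : (0 : ℝ) < n := by exact_mod_cast hn
  have h0 : conjugate C Ψ 0 = -Ψ (mirror C Ψ 0) := by
    have := hΨ.conjugate_gradient hC (hΨ.mirror_mem hC hne 0)
    rw [hΨ.gradient_mirror hC hne, inner_zero_left] at this
    linarith
  have key := sum_inner_sub_le hΨ hC (scale_pos hn T d)
    (x := fun t => point C Ψ F T l d t fun r => w r)
    (g := fun t => estimator F t (point C Ψ F T l d t fun r => w r) (w t) (l t fun r => w r))
    (a := n) (fun t => ?_) (fun t => point_mem hΨ hC hne T l d t _)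
    (fun t => scale_smul_gradient_point hΨ hC hne hn T l d w t)
    (fun t h => hF.abs_inner_estimator_le hΨ hC t (point_mem hΨ hC hne T l d t _) _ (hl t _) h)
    hy T
  · rw [h0, ← sub_eq_add_neg, ← Fin.sum_univ_eq_sum_range (fun t => inner ℝ
      (estimator F t (point C Ψ F T l d t fun r => w r) (w t) (l t fun r => w r))
      ((point C Ψ F T l d t fun r => w r) - y))] at key
    refine le_trans (le_of_eq (Finset.sum_congr rfl fun t _ => ?_)) key
    rw [hpast, hwω]
  · rw [div_le_iff₀ (scale_pos hn T d t)]
    linarith [le_scale n T d t]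

theorem play_mem (hΨ : IsSelfConcordantBarrier C ϑ Ψ) (hC : IsCompact C)
    (hne : (interior C).Nonempty) (hF : F.IsEigen C Ψ) (T : ℕ)
    (l : (t : ℕ) → (Fin t → Draw n) → Vec n) (d : ℕ → ℕ) (ω : Fin T → Draw n) (t : Fin T) :
    play C Ψ F T l d ω t ∈ C :=
  hF.action_mem hΨ hC t (point_mem hΨ hC hne T l d t _) _

theorem expect_sum_inner_play_eq (hΨ : IsSelfConcordantBarrier C ϑ Ψ) (hC : IsCompact C)
    (hne : (interior C).Nonempty) (hF : F.IsEigen C Ψ) (T : ℕ)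
    (l : (t : ℕ) → (Fin t → Draw n) → Vec n) (d : ℕ → ℕ) (y : Vec n) :
    (Finset.univ.expect fun ω : Fin T → Draw n =>
        ∑ t : Fin T, inner ℝ (l t (past ω t)) (play C Ψ F T l d ω t - y)) =
      Finset.univ.expect fun ω : Fin T → Draw n =>
        ∑ t : Fin T, inner ℝ (estimator F t (point C Ψ F T l d t (past ω t)) (ω t)
          (l t (past ω t))) (point C Ψ F T l d t (past ω t) - y) := by
  rw [Finset.expect_eq_sum_div_card, Finset.expect_eq_sum_div_card]
  congr 1
  rw [Finset.sum_comm, Finset.sum_comm (s := Finset.univ (α := Fin T → Draw n))]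
  refine Finset.sum_congr rfl fun t _ => ?_
  exact sum_past_congr t
    (f := fun h a => inner ℝ (l t h) (action F t (point C Ψ F T l d t h) a - y))
    (g := fun h a => inner ℝ (estimator F t (point C Ψ F T l d t h) a (l t h))
      (point C Ψ F T l d t h - y))
    (fun h => hF.sum_inner_action_eq hΨ hC t (point_mem hΨ hC hne T l d t h) _ _)

theorem inner_sub_le_two {l x y : Vec n} (hl : ∀ z ∈ C, |inner ℝ l z| ≤ 1) (hx : x ∈ C)
    (hy : y ∈ C) : inner ℝ l (x - y) ≤ 2 := by
  rw [inner_sub_right]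
  linarith [(abs_le.1 (hl x hx)).2, (abs_le.1 (hl y hy)).1]

theorem draws_univ_nonempty (hn : 1 ≤ n) (T : ℕ) :
    (Finset.univ : Finset (Fin T → Draw n)).Nonempty :=
  ⟨fun _ => (⟨0, hn⟩, 1), Finset.mem_univ _⟩

theorem expect_regret_le_two_mul (hΨ : IsSelfConcordantBarrier C ϑ Ψ) (hC : IsCompact C)
    (hne : (interior C).Nonempty) (hn : 1 ≤ n) (hF : F.IsEigen C Ψ) (T : ℕ)
    {l : (t : ℕ) → (Fin t → Draw n) → Vec n} (hl : ∀ t h, ∀ x ∈ C, |inner ℝ (l t h) x| ≤ 1)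
    (d : ℕ → ℕ) {y : Vec n} (hy : y ∈ C) :
    (Finset.univ.expect fun ω : Fin T → Draw n =>
      ∑ t : Fin T, inner ℝ (l t (past ω t)) (play C Ψ F T l d ω t - y)) ≤ 2 * T := by
  refine Finset.expect_le (draws_univ_nonempty hn T) fun ω _ => ?_
  refine (Finset.sum_le_card_nsmul (Finset.univ : Finset (Fin T)) _ 2 fun t _ =>
    inner_sub_le_two (hl t _) (play_mem hΨ hC hne hF T l d ω t) hy).trans_eq ?_
  simp [mul_comm]

theorem expect_regret_le (hΨ : IsSelfConcordantBarrier C ϑ Ψ) (hϑ : 0 < ϑ) (hC : IsCompact C)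
    (hCc : Convex ℝ C) (hne : (interior C).Nonempty) (hn : 1 ≤ n) (hF : F.IsEigen C Ψ)
    {T : ℕ} (hT : 1 ≤ T) {l : (t : ℕ) → (Fin t → Draw n) → Vec n}
    (hl : ∀ t h, ∀ x ∈ C, |inner ℝ (l t h) x| ≤ 1) (d : ℕ → ℕ) {y : Vec n} (hy : y ∈ C) :
    (Finset.univ.expect fun ω : Fin T → Draw n =>
      ∑ t : Fin T, inner ℝ (l t (past ω t)) (play C Ψ F T l d ω t - y)) ≤
      2 + ((∑ t ∈ Finset.range T, invest (scale n T d) d t) * (ϑ * Real.log (T + 1)) +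
        2 * ((n : ℝ) ^ 2 * ∑ t ∈ Finset.range T, (scale n T d t)⁻¹)) := by
  set x₀ := mirror C Ψ 0
  have hx₀ : x₀ ∈ interior C := hΨ.mirror_mem hC hne 0
  have hT' : (1 : ℝ) ≤ T := by exact_mod_cast hT
  -- Each round loses at most `2γ` by moving the comparator, so at most `2` in total, while `-log γ
  -- = log(T+1)`.
  set γ : ℝ := 1 / (T + 1) with hγ
  have hγ0 : 0 < γ := by positivity
  have hγ1 : γ < 1 := by rw [hγ, div_lt_one (by positivity)]; linarith
  set y' := x₀ + (1 - γ) • (y - x₀) with hy'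
  have hy'C : y' ∈ interior C := by
    have h1 := hCc.add_smul_sub_mem_interior hy hx₀ (t := γ) ⟨hγ0, hγ1.le⟩
    have e : y + γ • (x₀ - y) = y' := by rw [hy']; module
    rwa [e] at h1
  have hlog : Ψ y' - Ψ x₀ ≤ ϑ * Real.log (T + 1) := by
    have h1 := hΨ.le_sub_log hCc hϑ hx₀ hy (t := 1 - γ) (by linarith) (by linarith)
    have h2 : Real.log (1 - (1 - γ)) = -Real.log (T + 1) := by
      rw [sub_sub_cancel, hγ, one_div, Real.log_inv]
    rw [h2] at h1
    linarith
  have hbank : 0 ≤ ∑ t ∈ Finset.range T, invest (scale n T d) d t :=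
    Finset.sum_nonneg fun t _ => invest_nonneg (scale_nonneg n T d) t
  have hsplit : ∀ ω ∈ (Finset.univ : Finset (Fin T → Draw n)),
      ∑ t : Fin T, inner ℝ (l t (past ω t)) (play C Ψ F T l d ω t - y) ≤
      2 + ∑ t : Fin T, inner ℝ (l t (past ω t)) (play C Ψ F T l d ω t - y') := fun ω _ => by
    have h1 : ∀ t ∈ (Finset.univ : Finset (Fin T)),
        inner ℝ (l t (past ω t)) (play C Ψ F T l d ω t - y) ≤ γ * 2 +
          inner ℝ (l t (past ω t)) (play C Ψ F T l d ω t - y') := fun t _ => by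
      have e : play C Ψ F T l d ω t - y =
          γ • (x₀ - y) + (play C Ψ F T l d ω t - y') := by rw [hy']; module
      rw [e, inner_add_right, real_inner_smul_right]
      have h2 := inner_sub_le_two (hl t (past ω t)) (interior_subset hx₀) hy
      gcongr
    refine (Finset.sum_le_sum h1).trans ?_
    rw [Finset.sum_add_distrib, Finset.sum_const, Finset.card_univ, Fintype.card_fin,
      nsmul_eq_mul]
    refine add_le_add ?_ le_rfl
    have h3 : (T : ℝ) * γ ≤ 1 := by
      rw [hγ, mul_one_div, div_le_one (by positivity)]; linarith
    linarith
  refine (Finset.expect_le_expect hsplit).trans ?_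
  rw [Finset.expect_add_distrib, Finset.expect_const (draws_univ_nonempty hn T),
    expect_sum_inner_play_eq hΨ hC hne hF]
  refine add_le_add le_rfl (Finset.expect_le (draws_univ_nonempty hn T) fun ω _ => ?_)
  exact (sum_inner_estimator_le hΨ hC hne hn hF T hl d ω hy'C).trans
    (add_le_add (mul_le_mul_of_nonneg_left hlog hbank) le_rfl)

theorem sum_invest_scale_le (hn : 1 ≤ n) {T : ℕ} (hT : 2 ≤ T) (hnT : n ≤ T) (d : ℕ → ℕ) :
    ∑ t ∈ Finset.range T, invest (scale n T d) d t ≤ 10 * (√n * √T) +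
      20 * Real.log (T + 1) * (n * √((∑ t ∈ Finset.range T, d t : ℕ) : ℝ)) := by
  have hl : 0 ≤ Real.log ((T : ℝ) + 1) := Real.log_nonneg (le_add_of_nonneg_left T.cast_nonneg)
  refine sum_invest_le (scale_nonneg n T d) (by positivity) T fun t ht => ?_
  have h1 := sum_pending_scale_le' hn hT d hnT ht
  rwa [pending, Finset.sum_insert (by simp)] at h1

theorem expect_regret_le_of_barrier {c : ℝ} (hc : 0 < c)
    (hΨ : IsSelfConcordantBarrier C (c * n) Ψ) (hC : IsCompact C) (hCc : Convex ℝ C)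
    (hne : (interior C).Nonempty) (hn : 1 ≤ n) (hF : F.IsEigen C Ψ) {T : ℕ} (hT : 1 ≤ T)
    {l : (t : ℕ) → (Fin t → Draw n) → Vec n} (hl : ∀ t h, ∀ x ∈ C, |inner ℝ (l t h) x| ≤ 1)
    (d : ℕ → ℕ) {y : Vec n} (hy : y ∈ C) :
    (Finset.univ.expect fun ω : Fin T → Draw n =>
      ∑ t : Fin T, inner ℝ (l t (past ω t)) (play C Ψ F T l d ω t - y)) ≤
      (20 * c + 10) * Real.log (T + 1) ^ 2 * ((n : ℝ) ^ (3 / 2 : ℝ) * √(T : ℝ) +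
        (n : ℝ) ^ 2 * √((∑ t ∈ Finset.range T, d t : ℕ) : ℝ)) := by
  have hn' : (1 : ℝ) ≤ n := by exact_mod_cast hn
  have hT' : (1 : ℝ) ≤ T := by exact_mod_cast hT
  have h32 : (n : ℝ) ^ (3 / 2 : ℝ) = n * √n := by
    rw [Real.sqrt_eq_rpow, ← Real.rpow_one_add' (by linarith) (by norm_num)]
    norm_num
  rw [h32]
  set D : ℝ := ((∑ t ∈ Finset.range T, d t : ℕ) : ℝ) with hD
  set ℓ := Real.log ((T : ℝ) + 1) with hℓ
  have hl0 : 1 / 2 ≤ ℓ := half_le_log (by linarith)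
  have hsn : 1 ≤ √(n : ℝ) := Real.one_le_sqrt.2 hn'
  have hsT : 1 ≤ √(T : ℝ) := Real.one_le_sqrt.2 hT'
  have hsD : 0 ≤ √D := Real.sqrt_nonneg _
  have hTT := Real.mul_self_sqrt (by linarith : (0 : ℝ) ≤ T)
  have hnn := Real.mul_self_sqrt (by linarith : (0 : ℝ) ≤ n)
  set p := n * √(n : ℝ) * √(T : ℝ) with hp
  set q := (n : ℝ) ^ 2 * √D with hq
  have hq0 : 0 ≤ q := by positivity
  have hp1 : 1 ≤ p := one_le_mul_of_one_le_of_one_le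
    (one_le_mul_of_one_le_of_one_le hn' hsn) hsT
  -- Otherwise `T ≤ n`, and the trivial regret `2T` is already below `n^{3/2}√T`, up to a constant.
  by_cases hsmall : 2 ≤ T ∧ n ≤ T
  · obtain ⟨hT2, hnT⟩ := hsmall
    have hl1 : 1 ≤ ℓ := by
      have : (2 : ℝ) ≤ T := by exact_mod_cast hT2
      rw [hℓ, Real.le_log_iff_exp_le (by linarith)]
      linarith [Real.exp_one_lt_d9]
    refine (expect_regret_le hΨ (by positivity) hC hCc hne hn hF hT hl d hy).trans ?_
    have h1 := sum_invest_scale_le hn hT2 hnT d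
    have h2 := sum_inv_scale_le hn hT2 d
    rw [← hD, ← hℓ] at h1 h2
    rw [← hp, ← hq] at h2
    have h3 := mul_le_mul_of_nonneg_right h1 (by positivity : 0 ≤ c * n * ℓ)
    have e : (10 * (√(n : ℝ) * √T) + 20 * ℓ * (n * √D)) * (c * n * ℓ) =
        10 * c * (ℓ * p) + 20 * c * (ℓ ^ 2 * q) := by
      rw [hp, hq]; ring
    rw [e] at h3
    have hll : ℓ ≤ ℓ ^ 2 := by nlinarith
    have h4 : ℓ * p ≤ ℓ ^ 2 * p := mul_le_mul_of_nonneg_right hll (by linarith)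
    have h5 : ℓ * q ≤ ℓ ^ 2 * q := mul_le_mul_of_nonneg_right hll hq0
    have h6 : 1 ≤ ℓ ^ 2 * p := one_le_mul_of_one_le_of_one_le (hl1.trans hll) hp1
    have h7 : 10 * c * (ℓ * p) ≤ 20 * c * (ℓ ^ 2 * p) := by
      have : 0 ≤ c * (ℓ * p) := by positivity
      nlinarith [mul_le_mul_of_nonneg_left h4 hc.le]
    have h8 : 0 ≤ ℓ ^ 2 * q := by positivity
    linarith
  · refine (expect_regret_le_two_mul hΨ hC hne hn hF T hl d hy).trans ?_
    have hTp : (T : ℝ) ≤ p := by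
      have hTn : √(T : ℝ) ≤ √n := by
        refine Real.sqrt_le_sqrt ?_
        have : T ≤ n := by omega
        exact_mod_cast this
      rw [← hTT, hp]
      refine mul_le_mul_of_nonneg_right ?_ (by linarith)
      nlinarith
    have hll : 1 / 4 ≤ ℓ ^ 2 := by nlinarith
    have h1 : 1 / 4 * p ≤ ℓ ^ 2 * (p + q) :=
      mul_le_mul hll (by linarith) (by linarith) (by positivity)
    have h2 : 0 ≤ c * (ℓ ^ 2 * (p + q)) := by positivity
    linarith

end

end BankerBolo

end

theorem mainTheorem7 :
    ∃ k : ℕ, ∀ c : ℝ, 0 < c → ∃ K : ℝ, 0 < K ∧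
      ∀ (n : ℕ), 1 ≤ n →
      ∀ (C : Set (BankerBolo.Vec n)), IsCompact C → Convex ℝ C → (interior C).Nonempty →
      ∀ (ϑ : ℝ) (Ψ : BankerBolo.Vec n → ℝ), ϑ ≤ c * n →
        BankerBolo.IsSelfConcordantBarrier C ϑ Ψ →
      ∀ (F : BankerBolo.Frame n), F.IsEigen C Ψ →
      ∀ (T : ℕ), 1 ≤ T →
      ∀ (l : (t : ℕ) → (Fin t → BankerBolo.Draw n) → BankerBolo.Vec n),
        (∀ t h, ∀ x ∈ C, |inner ℝ (l t h) x| ≤ 1) →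
      ∀ (d : ℕ → ℕ),
        (∀ (ω : Fin T → BankerBolo.Draw n) (t : Fin T),
          BankerBolo.play C Ψ F T l d ω t ∈ C) ∧
        BankerBolo.pseudoRegret C Ψ F T l d ≤
          ((K * Real.log (T + 1) ^ k *
            ((n : ℝ) ^ (3 / 2 : ℝ) * √(T : ℝ) +
              (n : ℝ) ^ 2 * √((∑ t ∈ Finset.range T, d t : ℕ) : ℝ)) : ℝ) : EReal) := by
  -- One logarithm comes from the total investment and one from the barrier growth. The part `20 *
  -- c` pays for their product, and `10` for the stability term and the comparator shift.
  refine ⟨2, fun c hc => ⟨20 * c + 10, by positivity, ?_⟩⟩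
  intro n hn C hC hCc hne ϑ Ψ hϑ hΨ F hF T hT l hl d
  have hΨ' := hΨ.mono hϑ
  refine ⟨BankerBolo.play_mem hΨ' hC hne hF T l d, iSup₂_le fun y hy => ?_⟩
  exact EReal.coe_le_coe_iff.2
    (BankerBolo.expect_regret_le_of_barrier hc hΨ' hC hCc hne hn hF hT hl d hy)
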